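/- Fix $0<b<1$, an integer $N\ge 1$, a real $t>0$ and integers $0\le y_1<y_2<\dots<y_N$. The $N$-particle HL-PushTASEP with parameter $b$ started from $\vec y=(y_1,\dots,y_N)$ is the continuous-time Markov process $\vec x(t)=(x_1(t)<\dots<x_N(t))$ in $\mathbb{Z}_{\ge 0}$ with $\vec x(0)=\vec y$ and the following dynamics (with the convention $x_{N+1}=+\infty$). Each particle carries an independent exponential clock of rate $1$; when its clock rings, the particle becomes active. An active particle at $x_l$ whose right neighbour is at $x_{l+1}$ moves $j$ steps to the right with probability $(1-b)b^{j-1}$ for each $1\le j<x_{l+1}-x_l$, and with probability $b^{x_{l+1}-x_l-1}$ it moves to the position $x_{l+1}$; in the latter case the particle that was at $x_{l+1}$ becomes active and instantly moves by the same rule, independently, and so on. Write $P_{\vec y}(x_m(t)=x)$ for the probability that the $m$-th particle is at $x$ at time $t$. **Theorem.** For all $1\le m\le N$, all integers $x\ge 0$ and every real $R>0$ with $R>1+b+b/R$, $$ \begin{aligned} P_{\vec y}(x_m(t)=x)={}&(-1)^{m-1}b^{m(m-1)/2}\sum_{k=m}^{N}\ \sum_{\substack{S\subset\{1,\dots,N\}\\|S|=k}}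 b^{\kappa(S)-mk-k(k-1)/2}\binom{k-1}{m-1}_{b}\\ &\times\frac{1}{(2\pi \mathrm{i})^{k}}\oint\cdots\oint\ \prod_{\substack{i,j\in S\\ i<j}}\frac{z_j-z_i}{1-(1+b^{-1})z_i+b^{-1}z_iz_j}\cdot\frac{1-\prod_{i\in S}z_i}{\prod_{i\in S}(1-z_i)}\\ &\qquad\times\prod_{i\in S}z_i^{\,x-y_i-1}\exp\!\Big(-t\,\frac{1-z_i^{-1}}{1-bz_i^{-1}}\Big)\,dz_i , \end{aligned} $$ where every variable $z_i$, $i\in S$, runs over the positively oriented circle $|z_i|=R$, where $\kappa(S)=\sum_{i\in S}i$, and where $$\binom{n}{r}_{b}=\prod_{j=0}^{r-1}\frac{1-b^{\,n-j}}{1-b^{\,j+1}} .$$ (The condition on $R$ says that the circle encloses all the singularities of the integrands: it encloses $0$, $b$ and $1$, and when one of the variables $z_i$, $z_j$ lies on the circle, the value of the other one at which $1-(1+b^{-1})z_i+b^{-1}z_iz_j=0$ lies strictly inside.) -/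

import Mathlib

open MeasureTheory ProbabilityTheory Filter Topology
open scoped NNReal ENNReal

noncomputable section

namespace HLPushTASEP

/-- Configurations of `N` particles: strictly increasing positions `x 0 < x 1 < ... < x (N - 1)`
in the non-negative integers (particle number `i + 1` has index `i`). -/
abbrev State (N : ℕ) : Type := {x : Fin N → ℕ // StrictMono x}

/-- Position of the right neighbour of particle `l`; it is `+∞` for the last particle. -/
def next {N : ℕ} (x : State N) (l : Fin N) : ℕ∞ :=
  if h : l.1 + 1 < N then ((x.1 ⟨l.1 + 1, h⟩ : ℕ) : ℕ∞) else ⊤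

/-- Probability that an active particle at `a`, with right neighbour at `c > a`, moves to `a'`:
it moves by `j` steps with probability `(1 - b) * b ^ (j - 1)` for `1 ≤ j < c - a`, and it reaches
the position of its neighbour with probability `b ^ (c - a - 1)`. -/
def stepProb (b : ℝ) (a : ℕ) (c : ℕ∞) (a' : ℕ) : ℝ :=
  if a < a' ∧ (a' : ℕ∞) < c then (1 - b) * b ^ (a' - a - 1)
  else if (a' : ℕ∞) = c then b ^ (a' - a - 1)
  else 0

/-- When the clock of particle `i` rings in the configuration `x` and the new configuration is
`x'`, particle `l` is activated iff `i ≤ l` and each of the particles `i, ..., l - 1` has moved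
exactly to the old position of its right neighbour. -/
def Activated {N : ℕ} (i : Fin N) (x x' : State N) (l : Fin N) : Prop :=
  i ≤ l ∧ ∀ j : Fin N, i ≤ j → j < l → ((x'.1 j : ℕ) : ℕ∞) = next x j

open Classical in
/-- Probability that the configuration `x` becomes `x'` when the clock of particle `i` rings.
Activated particles move independently according to `stepProb`, the others do not move. -/
def jumpProb {N : ℕ} (b : ℝ) (i : Fin N) (x x' : State N) : ℝ :=
  ∏ l : Fin N,
    if Activated i x x' l then stepProb b (x.1 l) (next x l) (x'.1 l)
    else if x'.1 l = x.1 l then 1 else 0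

/-- The generator of the process on bounded functions: every particle has a clock of rate `1`. -/
def generator {N : ℕ} (b : ℝ) (f : State N → ℝ) (x : State N) : ℝ :=
  ∑ i : Fin N, ∑' x' : State N, jumpProb b i x x' * (f x' - f x)

/-- `X` is an `N`-particle HL-PushTASEP with parameter `b` started from `y`: a right-continuous
(for the discrete topology), adapted, jointly measurable process with `X 0 = y` almost surely that
solves the martingale problem for `generator b` on all bounded functions. -/
structure IsProcess {Ω : Type*} {mΩ : MeasurableSpace Ω} {N : ℕ} (b : ℝ) (y : State N)
    (μ : Measure Ω) (ℱ : Filtration ℝ≥0 mΩ) (X : ℝ≥0 → Ω → State N) : Prop where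
  measurable : Measurable (fun p : ℝ≥0 × Ω => X p.1 p.2)
  adapted : ∀ t, Measurable[ℱ t] (X t)
  rightContinuous : ∀ ω t, ∀ᶠ s in 𝓝[≥] t, X s ω = X t ω
  initial : ∀ᵐ ω ∂μ, X 0 ω = y
  martingale : ∀ f : State N → ℝ, (∃ C : ℝ, ∀ x, |f x| ≤ C) →
    Martingale
      (fun (t : ℝ≥0) ω => f (X t ω) - ∫ s in (0 : ℝ)..(t : ℝ), generator b f (X s.toNNReal ω))
      ℱ μ

/-- The Gaussian binomial coefficient
`(1 - q ^ n) ⋯ (1 - q ^ (n - k + 1)) / ((1 - q) ⋯ (1 - q ^ k))`, for `k ≤ n`. -/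
def qBinom (q : ℝ) (n k : ℕ) : ℝ :=
  ∏ j ∈ Finset.range k, (1 - q ^ (n - j)) / (1 - q ^ (j + 1))

/-- The sum of the elements of `S`, a set of particles numbered from `1` to `N`. -/
def kappa {N : ℕ} (S : Finset (Fin N)) : ℕ := ∑ i ∈ S, (i.1 + 1)

/-- The integrand attached to `k` particles with initial positions `y 0 < ... < y (k - 1)`. -/
def integrand (b t : ℝ) (x : ℕ) {k : ℕ} (y : Fin k → ℕ) (z : Fin k → ℂ) : ℂ :=
  (∏ i : Fin k, ∏ j ∈ Finset.Ioi i,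
      (z j - z i) / (1 - (1 + (b : ℂ)⁻¹) * z i + (b : ℂ)⁻¹ * z i * z j))
    * ((1 - ∏ i, z i) / ∏ i, (1 - z i))
    * ∏ i, (z i ^ ((x : ℤ) - (y i : ℤ) - 1)
        * Complex.exp (-(t : ℂ) * ((1 - (z i)⁻¹) / (1 - (b : ℂ) * (z i)⁻¹))))

/-- The `|S|`-fold integral `(2πi)^{-|S|} ∮ ⋯ ∮` over positively oriented circles `|z_i| = R`, the
variables being attached to the elements of `S` in increasing order. -/
def contourIntegral {N : ℕ} (b t R : ℝ) (x : ℕ) (y : State N) (S : Finset (Fin N)) : ℂ :=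
  (1 / (2 * (Real.pi : ℂ) * Complex.I) ^ S.card) *
    torusIntegral (integrand b t x (fun i => y.1 (S.orderEmbOfFin rfl i)))
      (0 : Fin S.card → ℂ) (fun _ => R)

end HLPushTASEP

end

/-!
The formula solves the backward equation of the process, with the indicator of `x_m = x` at time
`0`.

**Inverse variables.** For `w = z⁻¹` the circles become small circles about `0`. On and inside them
`1 - b w_i`, `1 - w_i` and the denominators of the two-body factors do not vanish, which is what
the condition on `R` says. A contour integral is then an integral against the uniform law on a
torus (`contourIntegral_eq`), and the starting point `y` enters only through `∏_{i ∈ S} w_i ^ y_i`.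
This also gives the integrals a meaning for arbitrary vectors `y : Fin N → ℕ`, ordered or not.

**Backward equation.** The formula without its exponential is a function of `y` of the form `mix b
R m c Q`. If the jumps did not interact, the generator would multiply the integrand by `∑_{i ∈ S}
(w_i - 1) / (1 - b w_i)`. Interaction amounts to boundary conditions at `y_l = y_{l+1}`: a
geometric jump `j ≥ 0` of particle `l` has the same effect as a geometric jump `j ≥ 1` of particle
`l + 1`. They hold for the sum over all sets `S` of a given size (`sum_integral_boundary`): the
difference of the two sides changes sign when the variables `l`, `l + 1` are exchanged and `S` is
replaced by its image under the transposition, as the denominator of the two-body factor cancels.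
For functions satisfying the boundary conditions, the sum over the pushing jumps collapses to
independent geometric jumps (`hasSum_jumpWeight`). So the `n`-th power of the generator inserts the
`n`-th power of the symbol (`generator_mix`).

**Martingale problem.** Expectations of bounded functions along the process are thus given by the
exponential series of the generator (`tendsto_sum_expectation`). The series can be summed inside
the integrals, which produces the exponential factor of the formula.

**Initial condition.** At `t = 0` everything reduces to the integrals of the interaction times `∏ 1
/ (1 - w_i)` times a monomial with strictly decreasing exponents. Such an integral is `0` if one
exponent is negative, and `1` otherwise (`integral_interaction_of_neg`,
`integral_interaction_of_strictAntiOn`). What remains is a sum over subsets of `{1, ..., p}`,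
evaluated by the Gaussian binomial theorem (`sum_pow_kappa`) and an orthogonality relation between
Gaussian binomial coefficients (`sum_qBinom_mul_qBinom`); it is the indicator that the `m`-th
particle is at `x` (`mix_initial`).
-/

noncomputable section

namespace HLPushTASEP

/-! ### The uniform measure on a torus -/

section Torus

/-- The uniform probability measure on the interval `[0, 2π]` of angles. -/
def angleLaw : Measure ℝ :=
  ENNReal.ofReal (2 * Real.pi)⁻¹ • volume.restrict (Set.Icc 0 (2 * Real.pi))

instance : IsProbabilityMeasure angleLaw := by
  constructor
  rw [angleLaw, Measure.smul_apply, Measure.restrict_apply MeasurableSet.univ, Set.univ_inter,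
    Real.volume_Icc, smul_eq_mul, sub_zero, ← ENNReal.ofReal_mul (by positivity),
    inv_mul_cancel₀ Real.two_pi_pos.ne', ENNReal.ofReal_one]

lemma integral_angleLaw (f : ℝ → ℂ) :
    ∫ θ, f θ ∂angleLaw = (2 * Real.pi : ℝ)⁻¹ • ∫ θ in (0 : ℝ)..2 * Real.pi, f θ := by
  rw [angleLaw, integral_smul_measure, ENNReal.toReal_ofReal (by positivity),
    intervalIntegral.integral_of_le Real.two_pi_pos.le, integral_Icc_eq_integral_Ioc]

/-- The law of `w = z⁻¹` when `z` is uniform on the circle `|z| = R`. In the variable `w`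
the integrands become holomorphic near the closed disc of radius `R⁻¹`, up to negative powers. -/
def invCircleLaw (R : ℝ) : Measure ℂ := angleLaw.map (fun θ => (circleMap 0 R θ)⁻¹)

lemma measurable_inv_circleMap (R : ℝ) : Measurable (fun θ => (circleMap 0 R θ)⁻¹) :=
  (continuous_circleMap 0 R).measurable.inv

instance (R : ℝ) : IsProbabilityMeasure (invCircleLaw R) :=
  Measure.isProbabilityMeasure_map (measurable_inv_circleMap R).aemeasurable

lemma ae_norm_eq {R : ℝ} (hR : 0 < R) : ∀ᵐ w ∂invCircleLaw R, ‖w‖ = R⁻¹ := by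
  rw [invCircleLaw, ae_map_iff (measurable_inv_circleMap R).aemeasurable
    (measurableSet_eq_fun measurable_norm measurable_const)]
  exact Eventually.of_forall fun θ => by simp [abs_of_pos hR]

lemma integral_invCircleLaw {R : ℝ} (hR : 0 < R) {f : ℂ → ℂ}
    (hf : ContinuousOn f {w | ‖w‖ = R⁻¹}) :
    ∫ w, f w ∂invCircleLaw R
      = (2 * Real.pi : ℝ)⁻¹ • ∫ θ in (0 : ℝ)..2 * Real.pi, f (circleMap 0 R θ)⁻¹ := by
  have hcl : MeasurableSet {w : ℂ | ‖w‖ = R⁻¹} :=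
    measurableSet_eq_fun measurable_norm measurable_const
  have h : AEStronglyMeasurable f (invCircleLaw R) := by
    rw [← Measure.restrict_eq_self_of_ae_mem (ae_norm_eq hR)]
    exact hf.aestronglyMeasurable hcl
  rw [← integral_angleLaw, invCircleLaw, integral_map (measurable_inv_circleMap R).aemeasurable h]

/-- The mean value property. -/
lemma integral_invCircleLaw_of_differentiableAt {R : ℝ} (hR : 0 < R) {f : ℂ → ℂ}
    (hf : ∀ w, ‖w‖ ≤ R⁻¹ → DifferentiableAt ℂ f w) : ∫ w, f w ∂invCircleLaw R = f 0 := by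
  have hc : ContinuousOn f {w | ‖w‖ = R⁻¹} :=
    fun w hw => (hf w (le_of_eq hw)).continuousAt.continuousWithinAt
  rw [integral_invCircleLaw hR hc]
  have h1 : ∀ θ : ℝ, f (circleMap 0 R θ)⁻¹ = (fun θ => f (circleMap 0 R⁻¹ θ)) (-θ) := by
    intro θ
    simp only [circleMap, zero_add]
    congr 1
    rw [mul_inv, ← Complex.exp_neg]
    push_cast
    ring_nf
  simp_rw [h1]
  rw [intervalIntegral.integral_comp_neg (fun θ => f (circleMap 0 R⁻¹ θ))]
  have hper : Function.Periodic (fun θ => f (circleMap 0 R⁻¹ θ)) (2 * Real.pi) := fun θ => by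
    simp only [periodic_circleMap 0 R⁻¹ θ]
  have h2 := hper.intervalIntegral_add_eq (-(2 * Real.pi)) 0
  rw [neg_add_cancel, zero_add] at h2
  rw [neg_zero, h2]
  have h3 : DiffContOnCl ℂ f (Metric.ball 0 |R⁻¹|) := by
    refine DifferentiableOn.diffContOnCl fun w hw => (hf w ?_).differentiableWithinAt
    have := Metric.closure_ball_subset_closedBall hw
    simpa [abs_of_pos hR] using this
  have h4 := h3.circleAverage
  rw [Real.circleAverage] at h4
  exact h4

lemma integral_invCircleLaw_inv_pow {R : ℝ} (hR : 0 < R) {n : ℕ} (hn : n ≠ 0) :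
    ∫ w, (w⁻¹) ^ n ∂invCircleLaw R = 0 := by
  have hc : ContinuousOn (fun w : ℂ => (w⁻¹) ^ n) {w | ‖w‖ = R⁻¹} := by
    refine (ContinuousOn.inv₀ continuousOn_id fun w hw => ?_).pow n
    have : ‖w‖ ≠ 0 := by rw [hw]; positivity
    simpa using this
  rw [integral_invCircleLaw hR hc]
  have h3 : DiffContOnCl ℂ (fun z : ℂ => z ^ n) (Metric.ball 0 |R|) :=
    (differentiable_id.pow n).diffContOnCl
  have h4 := h3.circleAverage
  rw [Real.circleAverage] at h4
  simp only [inv_inv]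
  rw [h4, zero_pow hn]

/-- The torus of points `w` with `|w_i| = R⁻¹` for all `i`. -/
def torus (ι : Type*) (R : ℝ) : Set (ι → ℂ) := {w | ∀ i, ‖w i‖ = R⁻¹}

lemma isCompact_torus {ι : Type*} [Finite ι] (R : ℝ) : IsCompact (torus ι R) := by
  have : torus ι R = Set.pi Set.univ fun _ => Metric.sphere (0 : ℂ) R⁻¹ := by
    ext w; simp [torus]
  rw [this]
  exact isCompact_univ_pi fun _ => isCompact_sphere _ _

variable {ι κ : Type*} [Fintype ι] [Fintype κ]

/-- The uniform probability measure on `torus ι R`. -/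
def torusLaw (ι : Type*) [Fintype ι] (R : ℝ) : Measure (ι → ℂ) :=
  Measure.pi fun _ => invCircleLaw R

instance (R : ℝ) : IsProbabilityMeasure (torusLaw ι R) := by
  unfold torusLaw; infer_instance

lemma ae_mem_torus {R : ℝ} (hR : 0 < R) : ∀ᵐ w ∂torusLaw ι R, w ∈ torus ι R := by
  refine ae_all_iff.2 ?_
  intro i
  exact (measurePreserving_eval (fun _ : ι => invCircleLaw R) i).quasiMeasurePreserving.ae
    (ae_norm_eq hR)

lemma integrable_of_continuousOn {R : ℝ} (hR : 0 < R) {F : (ι → ℂ) → ℂ}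
    (hF : ContinuousOn F (torus ι R)) : Integrable F (torusLaw ι R) := by
  rw [← Measure.restrict_eq_self_of_ae_mem (ae_mem_torus hR)]
  exact hF.integrableOn_compact (isCompact_torus R)

lemma integral_torusLaw_congr {R : ℝ} (hR : 0 < R) {F G : (ι → ℂ) → ℂ}
    (h : ∀ w ∈ torus ι R, F w = G w) : ∫ w, F w ∂torusLaw ι R = ∫ w, G w ∂torusLaw ι R :=
  integral_congr_ae ((ae_mem_torus hR).mono h)

lemma hasSum_integral_torusLaw {R : ℝ} (hR : 0 < R) {F : ℕ → (ι → ℂ) → ℂ} {G : (ι → ℂ) → ℂ}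
    (hF : ∀ j, ContinuousOn (F j) (torus ι R)) {β : ℕ → ℝ} (hβ : Summable β)
    (hFβ : ∀ j, ∀ w ∈ torus ι R, ‖F j w‖ ≤ β j)
    (h : ∀ w ∈ torus ι R, HasSum (fun j => F j w) (G w)) :
    HasSum (fun j => ∫ w, F j w ∂torusLaw ι R) (∫ w, G w ∂torusLaw ι R) :=
  hasSum_integral_of_dominated_convergence (fun j _ => β j)
    (fun j => (integrable_of_continuousOn hR (hF j)).aestronglyMeasurable)
    (fun j => (ae_mem_torus hR).mono (hFβ j)) (Eventually.of_forall fun _ => hβ)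
    (integrable_const _) ((ae_mem_torus hR).mono h)

lemma integral_torusLaw_comp_equiv (R : ℝ) (e : ι ≃ κ) (F : (ι → ℂ) → ℂ) :
    ∫ w, F (fun i => w (e i)) ∂torusLaw κ R = ∫ w, F w ∂torusLaw ι R := by
  have h := measurePreserving_piCongrLeft (fun _ : ι => invCircleLaw R) e.symm
  have h2 := h.integral_comp' (g := F)
  rw [torusLaw, torusLaw, ← h2]
  congr 1 with w
  congr 1
  ext i
  simpa using (MeasurableEquiv.piCongrLeft_apply_apply (β := fun _ : ι => ℂ) (e := e.symm)
    w (e i)).symm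

/-- Resampling one coordinate preserves the uniform measure on the torus. -/
lemma measurePreserving_update [DecidableEq ι] (R : ℝ) (i : ι) :
    MeasurePreserving (fun p : (ι → ℂ) × ℂ => Function.update p.1 i p.2)
      ((torusLaw ι R).prod (invCircleLaw R)) (torusLaw ι R) := by
  have hm : Measurable (fun p : (ι → ℂ) × ℂ => Function.update p.1 i p.2) :=
    measurable_pi_lambda _ fun j => by
      by_cases hj : j = i
      · subst hj; simpa using measurable_snd
      · simpa [hj, Function.comp_def] using (measurable_pi_apply j).comp measurable_fst
  refine ⟨hm, ?_⟩
  refine (Measure.pi_eq fun s hs => ?_).symm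
  rw [Measure.map_apply hm (MeasurableSet.univ_pi hs)]
  have : (fun p : (ι → ℂ) × ℂ => Function.update p.1 i p.2) ⁻¹' Set.pi Set.univ s
      = (Set.pi Set.univ (Function.update s i Set.univ)) ×ˢ s i := by
    ext ⟨w, ζ⟩
    simp only [Set.mem_preimage, Set.mem_pi, Set.mem_univ, true_imp_iff, Set.mem_prod]
    constructor
    · intro h
      refine ⟨fun j => ?_, by simpa using h i⟩
      by_cases hj : j = i
      · subst hj; simp
      · simpa [hj] using h j
    · rintro ⟨h, h'⟩ j
      by_cases hj : j = i
      · subst hj; simpa using h'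
      · simpa [hj] using h j
  rw [this, Measure.prod_prod, torusLaw, Measure.pi_pi,
    ← Finset.mul_prod_erase _ _ (Finset.mem_univ i), ← Finset.mul_prod_erase
      (s := Finset.univ) (fun j => invCircleLaw R (s j)) (Finset.mem_univ i)]
  simp only [Function.update_self, measure_univ, one_mul]
  rw [mul_comm]
  congr 1
  refine Finset.prod_congr rfl fun j hj => ?_
  rw [Function.update_of_ne (Finset.ne_of_mem_erase hj)]

lemma integral_update [DecidableEq ι] {R : ℝ} (hR : 0 < R) (i : ι) {F G : (ι → ℂ) → ℂ}
    (hF : ContinuousOn F (torus ι R))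
    (hG : ∀ w ∈ torus ι R, ∫ ζ, F (Function.update w i ζ) ∂invCircleLaw R = G w) :
    ∫ w, F w ∂torusLaw ι R = ∫ w, G w ∂torusLaw ι R := by
  have hI := integrable_of_continuousOn hR hF
  have hmp := measurePreserving_update (ι := ι) R i
  have hF' : AEStronglyMeasurable F (Measure.map
      (fun p : (ι → ℂ) × ℂ => Function.update p.1 i p.2)
      ((torusLaw ι R).prod (invCircleLaw R))) := by
    rw [hmp.map_eq]; exact hI.aestronglyMeasurable
  have h1 := integral_map hmp.measurable.aemeasurable hF'
  rw [hmp.map_eq] at h1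
  rw [h1, integral_prod (fun p : (ι → ℂ) × ℂ => F (Function.update p.1 i p.2))
    (hmp.integrable_comp_of_integrable hI)]
  exact integral_torusLaw_congr hR hG

/-- The coordinates are independent, so that an integral which involves only some of them can be
computed on the smaller torus. -/
lemma integral_torusLaw_comp_injective (R : ℝ) {e : κ → ι} (he : Function.Injective e)
    (F : (κ → ℂ) → ℂ) (hF : AEStronglyMeasurable F (torusLaw κ R)) :
    ∫ w, F (fun i => w (e i)) ∂torusLaw ι R = ∫ w, F w ∂torusLaw κ R := by
  have hi : iIndepFun (fun (i : ι) (w : ι → ℂ) => w i) (torusLaw ι R) :=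
    iIndepFun_pi (X := fun _ => id) (fun _ => aemeasurable_id)
  have h2 := (iIndepFun_iff_map_fun_eq_pi_map
    (fun i => (measurable_pi_apply (e i)).aemeasurable)).1 (hi.precomp he)
  have h3 : ∀ i, (torusLaw ι R).map (fun w => w (e i)) = invCircleLaw R := fun i =>
    (measurePreserving_eval (fun _ : ι => invCircleLaw R) (e i)).map_eq
  have h4 : (torusLaw ι R).map (fun (w : ι → ℂ) (i : κ) => w (e i)) = torusLaw κ R := by
    refine h2.trans ?_
    simp_rw [h3]
    rfl
  have hm : Measurable (fun (w : ι → ℂ) (i : κ) => w (e i)) :=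
    measurable_pi_lambda _ fun i => measurable_pi_apply _
  rw [← h4] at hF
  rw [← h4, integral_map hm.aemeasurable hF]

/-- A normalized torus integral is an integral in the inverse variables `w = z⁻¹`. -/
lemma torusIntegral_eq_integral_torusLaw {k : ℕ} {R : ℝ} (F : (Fin k → ℂ) → ℂ)
    (hF : AEStronglyMeasurable (fun w => (∏ i, (w i)⁻¹) * F fun i => (w i)⁻¹)
      (torusLaw (Fin k) R)) :
    1 / (2 * (Real.pi : ℂ) * Complex.I) ^ k * torusIntegral F (0 : Fin k → ℂ) (fun _ => R)
      = ∫ w, (∏ i, (w i)⁻¹) * F (fun i => (w i)⁻¹) ∂torusLaw (Fin k) R := by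
  have h1 : torusLaw (Fin k) R = (Measure.pi fun _ : Fin k => angleLaw).map
      (fun θ i => (circleMap 0 R (θ i))⁻¹) := by
    exact (Measure.pi_map_pi (μ := fun _ : Fin k => angleLaw)
      (fun _ => (measurable_inv_circleMap R).aemeasurable)).symm
  have hm : Measurable (fun (θ : Fin k → ℝ) i => (circleMap 0 R (θ i))⁻¹) :=
    measurable_pi_lambda _ fun i => (measurable_inv_circleMap R).comp (measurable_pi_apply i)
  have h2 : (Measure.pi fun _ : Fin k => angleLaw)
      = ENNReal.ofReal (2 * Real.pi)⁻¹ ^ k •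
        volume.restrict (Set.Icc 0 fun _ : Fin k => 2 * Real.pi) := by
    refine Measure.pi_eq fun s hs => ?_
    rw [← Set.pi_univ_Icc, volume_pi, Measure.restrict_pi_pi, Measure.smul_apply, Measure.pi_pi]
    simp [angleLaw, Finset.prod_mul_distrib]
  rw [h1] at hF
  rw [h1, integral_map hm.aemeasurable hF, h2, integral_smul_measure, torusIntegral,
    ENNReal.toReal_pow, ENNReal.toReal_ofReal (by positivity)]
  simp only [inv_inv, smul_eq_mul, Complex.real_smul]
  rw [← integral_const_mul, ← integral_const_mul]
  congr 1
  ext θ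
  have h3 : torusMap (0 : Fin k → ℂ) (fun _ => R) θ = fun i => circleMap 0 R (θ i) := by
    ext i; simp [torusMap, circleMap]
  rw [h3]
  have h4 : ∏ i, ((R : ℂ) * Complex.exp (θ i * Complex.I) * Complex.I)
      = (∏ i, circleMap 0 R (θ i)) * Complex.I ^ k := by
    rw [Finset.prod_mul_distrib]; simp [circleMap]
  rw [h4]
  push_cast
  rw [mul_pow]
  have : (Complex.I : ℂ) ^ k ≠ 0 := pow_ne_zero _ Complex.I_ne_zero
  have h5 : ((2 * (Real.pi : ℂ)) ^ k) ≠ 0 :=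
    pow_ne_zero _ (mul_ne_zero two_ne_zero (by exact_mod_cast Real.pi_ne_zero))
  rw [inv_pow]
  field_simp

end Torus

/-! ### Functions holomorphic on the closed polydisc -/

/-- `F` is complex differentiable at all points of the closed polydisc of radius `R⁻¹`. -/
def PolyHol {ι : Type*} [Fintype ι] (R : ℝ) (F : (ι → ℂ) → ℂ) : Prop :=
  ∀ w, (∀ i, ‖w i‖ ≤ R⁻¹) → DifferentiableAt ℂ F w

section PolyHol

variable {ι : Type*} [Fintype ι] {R : ℝ} {F G : (ι → ℂ) → ℂ}

lemma PolyHol.continuousOn (hF : PolyHol R F) : ContinuousOn F (torus ι R) :=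
  fun w hw => (hF w fun i => (hw i).le).continuousAt.continuousWithinAt

lemma polyHol_const (c : ℂ) : PolyHol R (fun _ : ι → ℂ => c) :=
  fun _ _ => differentiableAt_const c

lemma polyHol_coord (i : ι) : PolyHol R (fun w : ι → ℂ => w i) :=
  fun _ _ => differentiableAt_pi.1 differentiableAt_id i

lemma PolyHol.add (hF : PolyHol R F) (hG : PolyHol R G) : PolyHol R (fun w => F w + G w) :=
  fun w hw => (hF w hw).fun_add (hG w hw)

lemma PolyHol.sub (hF : PolyHol R F) (hG : PolyHol R G) : PolyHol R (fun w => F w - G w) :=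
  fun w hw => (hF w hw).fun_sub (hG w hw)

lemma PolyHol.mul (hF : PolyHol R F) (hG : PolyHol R G) : PolyHol R (fun w => F w * G w) :=
  fun w hw => (hF w hw).fun_mul (hG w hw)

lemma PolyHol.div (hF : PolyHol R F) (hG : PolyHol R G)
    (h0 : ∀ w, (∀ i, ‖w i‖ ≤ R⁻¹) → G w ≠ 0) : PolyHol R (fun w => F w / G w) :=
  fun w hw => by
    simp only [div_eq_mul_inv]
    exact (hF w hw).fun_mul ((differentiableAt_inv (h0 w hw)).comp w (hG w hw))

lemma PolyHol.prod {κ : Type*} {F : κ → (ι → ℂ) → ℂ} (s : Finset κ)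
    (hF : ∀ i ∈ s, PolyHol R (F i)) : PolyHol R (fun w => ∏ i ∈ s, F i w) := by
  classical
  induction s using Finset.induction_on with
  | empty => simpa using polyHol_const 1
  | insert a s ha ih =>
    simp only [Finset.prod_insert ha]
    exact (hF a (Finset.mem_insert_self _ _)).mul
      (ih fun i hi => hF i (Finset.mem_insert_of_mem hi))

lemma PolyHol.comp_update [DecidableEq ι] (hF : PolyHol R F) {w : ι → ℂ}
    (hw : ∀ i, ‖w i‖ ≤ R⁻¹) (i : ι) {ζ : ℂ} (hζ : ‖ζ‖ ≤ R⁻¹) :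
    DifferentiableAt ℂ (fun ζ => F (Function.update w i ζ)) ζ := by
  have h1 : DifferentiableAt ℂ F (Function.update w i ζ) := by
    refine hF _ fun j => ?_
    by_cases hj : j = i
    · subst hj; simpa using hζ
    · simpa [hj] using hw j
  exact h1.comp ζ (hasDerivAt_update w i ζ).differentiableAt

end PolyHol

/-! ### Monomials -/

section Monomial

variable {ι : Type*} [Fintype ι] [DecidableEq ι] {R : ℝ} {F : (ι → ℂ) → ℂ}

/-- The monomial `∏_{i ∈ S} w_i ^ (-n_i)`; integrating against it extracts the coefficient
of `∏_{i ∈ S} w_i ^ n_i`. -/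
def monom (S : Finset ι) (n : ι → ℤ) (w : ι → ℂ) : ℂ := ∏ i ∈ S, w i ^ (-n i)

omit [Fintype ι] [DecidableEq ι] in
lemma ne_zero_of_mem_torus (hR : 0 < R) {w : ι → ℂ} (hw : w ∈ torus ι R) (i : ι) : w i ≠ 0 := by
  have : ‖w i‖ ≠ 0 := by rw [hw i]; positivity
  simpa using this

omit [Fintype ι] [DecidableEq ι] in
lemma continuousOn_monom (hR : 0 < R) (S : Finset ι) (n : ι → ℤ) :
    ContinuousOn (monom S n) (torus ι R) := by
  refine continuousOn_finsetProd S fun i _ => ?_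
  exact (continuous_apply i).continuousOn.zpow₀ _ fun w hw =>
    Or.inl (ne_zero_of_mem_torus hR hw i)

omit [Fintype ι] in
lemma monom_update {S : Finset ι} {i : ι} (hi : i ∈ S) (n : ι → ℤ) (w : ι → ℂ) (ζ : ℂ) :
    monom S n (Function.update w i ζ) = ζ ^ (-n i) * monom (S.erase i) n w := by
  rw [monom, ← Finset.mul_prod_erase S _ hi, monom]
  simp only [Function.update_self]
  congr 1
  refine Finset.prod_congr rfl fun j hj => ?_
  rw [Function.update_of_ne (Finset.ne_of_mem_erase hj)]

omit [Fintype ι] in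
lemma monom_sub_single (hR : 0 < R) {S : Finset ι} {i : ι} (hi : i ∈ S) (n : ι → ℤ) {w : ι → ℂ}
    (hw : w ∈ torus ι R) : monom S (n - Pi.single i 1) w = w i * monom S n w := by
  have h0 := ne_zero_of_mem_torus hR hw
  rw [monom, ← Finset.mul_prod_erase S _ hi, monom, ← Finset.mul_prod_erase S _ hi, ← mul_assoc]
  congr 1
  · rw [Pi.sub_apply, Pi.single_eq_same, neg_sub, sub_eq_add_neg, zpow_add₀ (h0 i), zpow_one]
  · refine Finset.prod_congr rfl fun j hj => ?_
    rw [Pi.sub_apply, Pi.single_eq_of_ne (Finset.ne_of_mem_erase hj), sub_zero]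

/-- Cauchy's theorem in the variable `w_i`: a holomorphic function has no negative powers. -/
lemma integral_mul_monom_of_neg (hR : 0 < R) (hF : PolyHol R F) {S : Finset ι} {i : ι}
    (hi : i ∈ S) {n : ι → ℤ} (hn : n i < 0) : ∫ w, F w * monom S n w ∂torusLaw ι R = 0 := by
  rw [integral_update (G := fun _ => 0) hR i (hF.continuousOn.fun_mul (continuousOn_monom hR S n))]
  · simp
  intro w hw
  obtain ⟨m, hm⟩ : ∃ m : ℕ, -n i = m + 1 := ⟨(-n i - 1).toNat, by omega⟩
  simp only [monom_update hi, hm]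
  have hd : ∀ ζ : ℂ, ‖ζ‖ ≤ R⁻¹ → DifferentiableAt ℂ (fun ζ => F (Function.update w i ζ)
      * (ζ ^ ((m : ℤ) + 1) * monom (S.erase i) n w)) ζ := by
    intro ζ hζ
    refine (hF.comp_update (fun i => (hw i).le) i hζ).fun_mul (DifferentiableAt.mul_const ?_ _)
    have : (fun ζ : ℂ => ζ ^ ((m : ℤ) + 1)) = fun ζ => ζ ^ (m + 1) := by
      ext ζ; exact_mod_cast zpow_natCast ζ (m + 1)
    rw [this]
    exact differentiableAt_id.pow _
  rw [integral_invCircleLaw_of_differentiableAt hR hd]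
  have : (0 : ℂ) ^ ((m : ℤ) + 1) = 0 := zero_zpow _ (by omega)
  simp [this]

/-- A function which does not depend on `w_i` has no positive powers of `w_i`. -/
lemma integral_mul_monom_of_pos (hR : 0 < R) (hF : ContinuousOn F (torus ι R)) {S : Finset ι}
    {i : ι} (hi : i ∈ S) (hFi : ∀ w ζ, F (Function.update w i ζ) = F w) {n : ι → ℤ}
    (hn : 0 < n i) : ∫ w, F w * monom S n w ∂torusLaw ι R = 0 := by
  rw [integral_update (G := fun _ => 0) hR i (hF.fun_mul (continuousOn_monom hR S n))]
  · simp
  intro w hw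
  obtain ⟨m, hm⟩ : ∃ m : ℕ, n i = m := ⟨(n i).toNat, by omega⟩
  have h : ∀ ζ : ℂ, F (Function.update w i ζ) * monom S n (Function.update w i ζ)
      = (ζ⁻¹) ^ m * (F w * monom (S.erase i) n w) := by
    intro ζ
    rw [monom_update hi, hFi, hm, zpow_neg, zpow_natCast, inv_pow]
    ring
  simp_rw [h]
  rw [integral_mul_const, integral_invCircleLaw_inv_pow hR (by omega), zero_mul]

lemma integral_invCircleLaw_geometric (hR : 1 < R) (m : ℕ) :
    ∫ w, (w⁻¹) ^ m * (1 / (1 - w)) ∂invCircleLaw R = 1 := by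
  have hR0 : 0 < R := by linarith
  have hR1 : R⁻¹ < 1 := inv_lt_one_of_one_lt₀ hR
  have h1 : ∀ w : ℂ, ‖w‖ ≤ R⁻¹ → 1 - w ≠ 0 := by
    intro w hw h
    rw [← sub_eq_zero.1 h, norm_one] at hw
    linarith
  have hint : ∀ {f : ℂ → ℂ}, ContinuousOn f (Metric.sphere 0 R⁻¹) →
      Integrable f (invCircleLaw R) := by
    intro f hf
    rw [← Measure.restrict_eq_self_of_ae_mem (s := Metric.sphere (0 : ℂ) R⁻¹)
      ((ae_norm_eq hR0).mono fun w hw => by simpa using hw)]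
    exact hf.integrableOn_compact (isCompact_sphere _ _)
  have hc0 : ContinuousOn (fun w : ℂ => w⁻¹) (Metric.sphere 0 R⁻¹) :=
    continuousOn_id.inv₀ fun w hw => Metric.ne_of_mem_sphere hw (by positivity)
  have hc1 : ContinuousOn (fun w : ℂ => 1 / (1 - w)) (Metric.sphere 0 R⁻¹) :=
    continuousOn_const.div (continuousOn_const.sub continuousOn_id)
      fun w hw => h1 w (by simpa using (mem_sphere_zero_iff_norm.1 hw).le)
  induction m with
  | zero =>
    simp only [pow_zero, one_mul]
    rw [integral_invCircleLaw_of_differentiableAt hR0]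
    · simp
    · intro w hw
      exact (differentiableAt_const _).fun_div ((differentiableAt_const _).sub differentiableAt_id)
        (h1 w hw)
  | succ m ih =>
    have : ∀ᵐ w ∂invCircleLaw R, (w⁻¹) ^ (m + 1) * (1 / (1 - w))
        = (w⁻¹) ^ (m + 1) + (w⁻¹) ^ m * (1 / (1 - w)) := by
      filter_upwards [ae_norm_eq hR0] with w hw
      have h2 := h1 w hw.le
      have h3 : w ≠ 0 := by
        have : ‖w‖ ≠ 0 := by rw [hw]; positivity
        simpa using this
      rw [pow_succ]
      generalize (w⁻¹) ^ m = a
      field_simp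
      ring
    rw [integral_congr_ae this, integral_add (hint (hc0.fun_pow _))
      (hint ((hc0.fun_pow _).fun_mul hc1)), ih, integral_invCircleLaw_inv_pow hR0 (by omega), zero_add]

lemma integral_geometric_mul_monom (hR : 1 < R) (hF : ContinuousOn F (torus ι R)) {S : Finset ι}
    {i : ι} (hi : i ∈ S) (hFi : ∀ w ζ, F (Function.update w i ζ) = F w) {n : ι → ℤ}
    (hn : 0 ≤ n i) : ∫ w, F w * (1 / (1 - w i)) * monom S n w ∂torusLaw ι R
      = ∫ w, F w * monom (S.erase i) n w ∂torusLaw ι R := by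
  have hR0 : 0 < R := by linarith
  have hc : ContinuousOn (fun w : ι → ℂ => 1 / (1 - w i)) (torus ι R) := by
    refine continuousOn_const.div (continuousOn_const.sub (continuous_apply i).continuousOn) ?_
    intro w hw h
    have h1 := hw i
    rw [← sub_eq_zero.1 h, norm_one] at h1
    exact absurd h1 (inv_lt_one_of_one_lt₀ hR).ne'
  rw [integral_update hR0 i ((hF.fun_mul hc).fun_mul (continuousOn_monom hR0 S n))]
  intro w hw
  obtain ⟨m, hm⟩ : ∃ m : ℕ, n i = m := ⟨(n i).toNat, by omega⟩
  have h : ∀ ζ : ℂ, F (Function.update w i ζ) * (1 / (1 - Function.update w i ζ i))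
      * monom S n (Function.update w i ζ)
      = (ζ⁻¹) ^ m * (1 / (1 - ζ)) * (F w * monom (S.erase i) n w) := by
    intro ζ
    rw [monom_update hi, hFi, hm, zpow_neg, zpow_natCast, inv_pow, Function.update_self]
    ring
  simp_rw [h]
  rw [integral_mul_const, integral_invCircleLaw_geometric hR, one_mul]

end Monomial

/-! ### The interaction factor and its power series coefficients -/

section Interaction

/-- The polynomial `1 - (1 + b) v + b u v`, which is
`b u v (1 - (1 + b⁻¹) z_i + b⁻¹ z_i z_j)` for `u = z_i⁻¹`, `v = z_j⁻¹`. -/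
def den (b : ℝ) (u v : ℂ) : ℂ := 1 - (1 + b) * v + b * u * v

/-- The two-body factor attached to the inverse variables `u`, `v` of two particles `i < j`. -/
def ratio (b : ℝ) (u v : ℂ) : ℂ := (u - v) / den b u v

lemma one_lt_radius {b R : ℝ} (hb0 : 0 < b) (hR0 : 0 < R) (hR : 1 + b + b / R < R) : 1 < R := by
  have : 0 < b / R := by positivity
  linarith

/-- This is where the condition on `R` enters. -/
lemma den_ne_zero {b R : ℝ} (hb0 : 0 < b) (hR0 : 0 < R) (hR : 1 + b + b / R < R) {u v : ℂ}
    (hu : ‖u‖ ≤ R⁻¹) (hv : ‖v‖ ≤ R⁻¹) : den b u v ≠ 0 := by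
  intro h
  have h1 : (1 : ℂ) = (1 + b) * v - b * u * v := by
    rw [den] at h
    linear_combination h
  have h2 : (1 : ℝ) ≤ (1 + b) * ‖v‖ + b * ‖u‖ * ‖v‖ := by
    calc (1 : ℝ) = ‖(1 : ℂ)‖ := by simp
      _ = ‖(1 + b : ℝ) * v - (b : ℂ) * u * v‖ := by rw [h1]; push_cast; rfl
      _ ≤ ‖(1 + b : ℝ) * v‖ + ‖(b : ℂ) * u * v‖ := norm_sub_le _ _
      _ = _ := by
        rw [norm_mul, norm_mul, norm_mul, Complex.norm_real, Complex.norm_real,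
          Real.norm_of_nonneg (by positivity), Real.norm_of_nonneg hb0.le]
  have h3 : (1 + b) * ‖v‖ + b * ‖u‖ * ‖v‖ ≤ (1 + b) * R⁻¹ + b * R⁻¹ * R⁻¹ := by gcongr
  have h4 : (1 + b) * R⁻¹ + b * R⁻¹ * R⁻¹ = (1 + b + b / R) * R⁻¹ := by ring
  have h5 : (1 + b + b / R) * R⁻¹ < R * R⁻¹ := by gcongr
  rw [mul_inv_cancel₀ hR0.ne'] at h5
  linarith

variable {ι : Type*} [LinearOrder ι]

/-- The product of the two-body factors over all pairs `i < j` in `S`. -/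
def interaction (b : ℝ) (S : Finset ι) (w : ι → ℂ) : ℂ :=
  ∏ i ∈ S, ∏ j ∈ S, if i < j then ratio b (w i) (w j) else 1

lemma interaction_insert_max (b : ℝ) {S : Finset ι} {a : ι} (ha : ∀ i ∈ S, i < a) (w : ι → ℂ) :
    interaction b (insert a S) w = interaction b S w * ∏ i ∈ S, ratio b (w i) (w a) := by
  have h : a ∉ S := fun h => lt_irrefl a (ha a h)
  have h1 : ∀ j ∈ S, (if a < j then ratio b (w a) (w j) else 1) = 1 := fun j hj =>
    if_neg (ha j hj).not_gt
  simp only [interaction, Finset.prod_insert h, lt_irrefl, if_false, one_mul,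
    Finset.prod_congr rfl h1, Finset.prod_const_one, Finset.prod_mul_distrib]
  rw [mul_comm]
  congr 1
  exact Finset.prod_congr rfl fun i hi => if_pos (ha i hi)

lemma interaction_insert_min (b : ℝ) {S : Finset ι} {a : ι} (ha : ∀ i ∈ S, a < i) (w : ι → ℂ) :
    interaction b (insert a S) w = interaction b S w * ∏ i ∈ S, ratio b (w a) (w i) := by
  have h : a ∉ S := fun h => lt_irrefl a (ha a h)
  have h1 : ∀ j ∈ S, (if j < a then ratio b (w j) (w a) else 1) = 1 := fun j hj =>
    if_neg (ha j hj).not_gt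
  simp only [interaction, Finset.prod_insert h, lt_irrefl, if_false, one_mul,
    Finset.prod_congr rfl h1, Finset.prod_const_one, Finset.prod_mul_distrib]
  rw [mul_comm]
  congr 1
  exact Finset.prod_congr rfl fun i hi => if_pos (ha i hi)

lemma interaction_update (b : ℝ) {S : Finset ι} {a : ι} (ha : a ∉ S) (w : ι → ℂ) (ζ : ℂ) :
    interaction b S (Function.update w a ζ) = interaction b S w := by
  refine Finset.prod_congr rfl fun i hi => Finset.prod_congr rfl fun j hj => ?_
  rw [Function.update_of_ne (ne_of_mem_of_not_mem hi ha),
    Function.update_of_ne (ne_of_mem_of_not_mem hj ha)]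

variable [Fintype ι] {b R : ℝ}

omit [LinearOrder ι] in
lemma polyHol_den (b : ℝ) (i j : ι) : PolyHol R (fun w : ι → ℂ => den b (w i) (w j)) :=
  ((polyHol_const 1).sub ((polyHol_const _).mul (polyHol_coord j))).add
    (((polyHol_const _).mul (polyHol_coord i)).mul (polyHol_coord j))

variable (hb0 : 0 < b) (hR0 : 0 < R) (hR : 1 + b + b / R < R)

include hb0 hR0 hR

omit [LinearOrder ι] in
lemma polyHol_inv_den (i j : ι) : PolyHol R (fun w : ι → ℂ => 1 / den b (w i) (w j)) :=
  (polyHol_const 1).div (polyHol_den b i j) fun _ hw => den_ne_zero hb0 hR0 hR (hw i) (hw j)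

omit [LinearOrder ι] in
lemma polyHol_ratio (i j : ι) : PolyHol R (fun w : ι → ℂ => ratio b (w i) (w j)) :=
  ((polyHol_coord i).sub (polyHol_coord j)).div (polyHol_den b i j)
    fun _ hw => den_ne_zero hb0 hR0 hR (hw i) (hw j)

lemma polyHol_interaction (S : Finset ι) : PolyHol R (interaction (ι := ι) b S) := by
  refine PolyHol.prod S fun i _ => PolyHol.prod S fun j _ => ?_
  by_cases h : i < j
  · simpa [h] using polyHol_ratio hb0 hR0 hR i j
  · simpa [h] using polyHol_const 1

omit [LinearOrder ι] in
lemma polyHol_geometric (i : ι) : PolyHol R (fun w : ι → ℂ => 1 / (1 - w i)) := by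
  refine (polyHol_const 1).div ((polyHol_const 1).sub (polyHol_coord i)) fun w hw h => ?_
  have h1 := hw i
  rw [← sub_eq_zero.1 h, norm_one] at h1
  exact absurd h1 (inv_lt_one_of_one_lt₀ (one_lt_radius hb0 hR0 hR)).not_ge

/-- In the expansion of `1 / den b (w_a) (w_j)` every power of `w_a` comes with at least the same
power of `w_j`; multiplication by a series without `w_a` does not change this. -/
lemma integral_inv_den_mul_monom {S : Finset ι} {a j : ι} (haS : a ∈ S) (hjS : j ∈ S) (haj : a ≠ j)
    {n : ι → ℤ} (hn : n j < n a) {Ψ : (ι → ℂ) → ℂ} (hΨ : PolyHol R Ψ)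
    (hΨa : ∀ w ζ, Ψ (Function.update w a ζ) = Ψ w) :
    ∫ w, 1 / den b (w a) (w j) * Ψ w * monom S n w ∂torusLaw ι R = 0 := by
  obtain ⟨p, hp⟩ : ∃ p : ℕ, n j < p := ⟨(n j + 1).toNat, by omega⟩
  induction p generalizing n Ψ with
  | zero =>
    exact integral_mul_monom_of_neg hR0 ((polyHol_inv_den hb0 hR0 hR a j).mul hΨ) hjS
      (by simpa using hp)
  | succ p ih =>
    by_cases hj : n j < 0
    · exact integral_mul_monom_of_neg hR0 ((polyHol_inv_den hb0 hR0 hR a j).mul hΨ) hjS hj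
    -- `1 / D = 1 / A - b w_a w_j / (A D)` with `A = 1 - (1 + b) w_j` free of `w_a`.
    have hA : PolyHol R (fun w : ι → ℂ => 1 / den b 0 (w j)) := by
      refine (polyHol_const 1).div (((polyHol_const 1).sub ((polyHol_const _).mul
        (polyHol_coord j))).add (((polyHol_const _).mul (polyHol_const 0)).mul
        (polyHol_coord j))) fun w hw => den_ne_zero hb0 hR0 hR ?_ (hw j)
      rw [norm_zero]; positivity
    have hAΨ : PolyHol R (fun w => 1 / den b 0 (w j) * Ψ w) := hA.mul hΨ
    have hAΨa : ∀ (w : ι → ℂ) ζ, 1 / den b 0 (Function.update w a ζ j)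
        * Ψ (Function.update w a ζ) = 1 / den b 0 (w j) * Ψ w := by
      intro w ζ
      rw [hΨa, Function.update_of_ne haj.symm]
    set n' : ι → ℤ := n - Pi.single a 1 - Pi.single j 1 with hn'
    have h1 : ∀ w ∈ torus ι R, 1 / den b (w a) (w j) * Ψ w * monom S n w
        = 1 / den b 0 (w j) * Ψ w * monom S n w
          - b * (1 / den b (w a) (w j) * (1 / den b 0 (w j) * Ψ w) * monom S n' w) := by
      intro w hw
      rw [hn', monom_sub_single hR0 hjS _ hw, monom_sub_single hR0 haS _ hw]
      have h2 := den_ne_zero hb0 hR0 hR (hw a).le (hw j).le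
      have h3 : den b 0 (w j) ≠ 0 := den_ne_zero hb0 hR0 hR (by rw [norm_zero]; positivity)
        (hw j).le
      have h4 : den b 0 (w j) = den b (w a) (w j) - b * w a * w j := by simp [den]
      field_simp
      rw [h4]; ring
    have hc := continuousOn_monom (ι := ι) hR0 S
    rw [integral_torusLaw_congr hR0 h1, integral_sub, integral_const_mul,
      integral_mul_monom_of_pos hR0 hAΨ.continuousOn haS hAΨa (by omega), ih _ hAΨ hAΨa]
    · simp
    · simp only [hn', Pi.sub_apply, Pi.single_eq_same,
        Pi.single_eq_of_ne haj.symm, Nat.cast_succ] at hp ⊢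
      omega
    · simp only [hn', Pi.sub_apply, Pi.single_eq_same, Pi.single_eq_of_ne haj,
        Pi.single_eq_of_ne haj.symm]
      omega
    · exact integrable_of_continuousOn hR0 (hAΨ.continuousOn.fun_mul (hc n))
    · exact integrable_of_continuousOn hR0 (continuousOn_const.fun_mul
        (((polyHol_inv_den hb0 hR0 hR a j).mul hAΨ).continuousOn.fun_mul (hc n')))

omit hb0 hR0 hR in
/-- `F` is continuous on the torus and all the products of `F` with functions holomorphic on the
polydisc that do not depend on `w_a` have zero coefficient at `∏_{i ∈ S} w_i ^ n_i`. -/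
def Vanishing (R : ℝ) (S : Finset ι) (a : ι) (n : ι → ℤ) (F : (ι → ℂ) → ℂ) : Prop :=
  ContinuousOn F (torus ι R) ∧ ∀ Ψ : (ι → ℂ) → ℂ, PolyHol R Ψ →
    (∀ w ζ, Ψ (Function.update w a ζ) = Ψ w) →
      ∫ w, F w * Ψ w * monom S n w ∂torusLaw ι R = 0

omit hb0 hR in
lemma Vanishing.congr {S : Finset ι} {a : ι} {n : ι → ℤ} {F G : (ι → ℂ) → ℂ}
    (hF : Vanishing R S a n F) (h : ∀ w ∈ torus ι R, G w = F w) : Vanishing R S a n G := by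
  refine ⟨hF.1.congr h, fun Ψ hΨ hΨa => ?_⟩
  rw [← hF.2 Ψ hΨ hΨa]
  exact integral_torusLaw_congr hR0 fun w hw => by rw [h w hw]

omit hb0 hR in
lemma Vanishing.add {S : Finset ι} {a : ι} {n : ι → ℤ} {F G : (ι → ℂ) → ℂ}
    (hF : Vanishing R S a n F) (hG : Vanishing R S a n G) :
    Vanishing R S a n (fun w => F w + G w) := by
  refine ⟨hF.1.fun_add hG.1, fun Ψ hΨ hΨa => ?_⟩
  have hc := continuousOn_monom (ι := ι) hR0 S n
  simp only [add_mul]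
  rw [integral_add, hF.2 Ψ hΨ hΨa, hG.2 Ψ hΨ hΨa, add_zero]
  · exact integrable_of_continuousOn hR0 ((hF.1.fun_mul hΨ.continuousOn).fun_mul hc)
  · exact integrable_of_continuousOn hR0 ((hG.1.fun_mul hΨ.continuousOn).fun_mul hc)

omit hb0 hR0 hR in
lemma Vanishing.mul {S : Finset ι} {a : ι} {n : ι → ℤ} {F Φ : (ι → ℂ) → ℂ}
    (hF : Vanishing R S a n F) (hΦ : PolyHol R Φ)
    (hΦa : ∀ w ζ, Φ (Function.update w a ζ) = Φ w) : Vanishing R S a n (fun w => F w * Φ w) := by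
  refine ⟨hF.1.fun_mul hΦ.continuousOn, fun Ψ hΨ hΨa => ?_⟩
  simp only [mul_assoc (F _) (Φ _)]
  exact hF.2 _ (hΦ.mul hΨ) fun w ζ => by rw [hΦa, hΨa]

/-- A three-term identity (partial fractions in `w_a`) removes the particles between `a` and `j`
one at a time. -/
lemma vanishing_chain {S : Finset ι} {a : ι} {n : ι → ℤ} (haS : a ∈ S)
    (hn : ∀ j ∈ S, j ≠ a → n j < n a) (A : Finset ι) (hA : A ⊆ S.erase a) {j : ι}
    (hj : j ∈ S.erase a) (hAj : ∀ l ∈ A, l < j) :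
    Vanishing R S a n (fun w => interaction b A w
      * (∏ l ∈ A, ratio b (w a) (w l) * ratio b (w l) (w j)) * (1 / den b (w a) (w j))) := by
  induction A using Finset.induction_on_max generalizing j with
  | empty =>
    simp only [interaction, Finset.prod_empty, one_mul]
    refine ⟨(polyHol_inv_den hb0 hR0 hR a j).continuousOn, fun Ψ hΨ hΨa => ?_⟩
    obtain ⟨hja, hjS⟩ := Finset.mem_erase.1 hj
    exact integral_inv_den_mul_monom hb0 hR0 hR haS hjS hja.symm (hn j hjS hja) hΨ hΨa
  | insert c A hc ih =>
    have hcA : c ∉ A := fun h => lt_irrefl c (hc c h)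
    have hcS : c ∈ S.erase a := hA (Finset.mem_insert_self c A)
    have hAS : A ⊆ S.erase a := (Finset.subset_insert c A).trans hA
    have hca : c ≠ a := Finset.ne_of_mem_erase hcS
    have hja : j ≠ a := Finset.ne_of_mem_erase hj
    have hla : ∀ l ∈ A, l ≠ a := fun l hl => Finset.ne_of_mem_erase (hAS hl)
    have h1 := ih hAS hj fun l hl => hAj l (Finset.mem_insert_of_mem hl)
    have h2 := ih hAS hcS hc
    have hΦ1 : PolyHol R (fun w : ι → ℂ => (b : ℂ)⁻¹ * ∏ l ∈ A, ratio b (w l) (w c)) :=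
      (polyHol_const _).mul (PolyHol.prod A fun l _ => polyHol_ratio hb0 hR0 hR l c)
    have hΦ2 : PolyHol R (fun w : ι → ℂ => -(b : ℂ)⁻¹ * ((1 - w c) * (1 - b * w c)
        * (1 / den b (w c) (w j)) * ∏ l ∈ A, ratio b (w l) (w j))) :=
      (polyHol_const _).mul (((((polyHol_const _).sub (polyHol_coord c)).mul
        ((polyHol_const _).sub ((polyHol_const _).mul (polyHol_coord c)))).mul
        (polyHol_inv_den hb0 hR0 hR c j)).mul
        (PolyHol.prod A fun l _ => polyHol_ratio hb0 hR0 hR l j))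
    have h3 := h1.mul hΦ1 fun w ζ => by
      congr 1
      refine Finset.prod_congr rfl fun l hl => ?_
      rw [Function.update_of_ne (hla l hl), Function.update_of_ne hca]
    have h4 := h2.mul hΦ2 fun w ζ => by
      rw [Function.update_of_ne hca, Function.update_of_ne hja]
      congr 2
      refine Finset.prod_congr rfl fun l hl => ?_
      rw [Function.update_of_ne (hla l hl)]
    refine (h3.add hR0 h4).congr hR0 fun w hw => ?_
    rw [interaction_insert_max b hc, Finset.prod_insert hcA]
    simp only [Finset.prod_mul_distrib]
    have key : ratio b (w a) (w c) * ratio b (w c) (w j) * (1 / den b (w a) (w j))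
        = (b : ℂ)⁻¹ * (1 / den b (w a) (w j)) - (b : ℂ)⁻¹ * ((1 - w c) * (1 - b * w c)
          * (1 / den b (w c) (w j)) * (1 / den b (w a) (w c))) := by
      have d1 := den_ne_zero hb0 hR0 hR (hw a).le (hw c).le
      have d2 := den_ne_zero hb0 hR0 hR (hw c).le (hw j).le
      have d3 := den_ne_zero hb0 hR0 hR (hw a).le (hw j).le
      have hb : (b : ℂ) ≠ 0 := by exact_mod_cast hb0.ne'
      unfold ratio
      field_simp
      unfold den
      ring
    linear_combination (interaction b A w * (∏ l ∈ A, ratio b (w a) (w l))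
      * (∏ l ∈ A, ratio b (w l) (w j)) * ∏ l ∈ A, ratio b (w l) (w c)) * key

/-- Replacing `∏_l ratio b (w_a) (w_l)` by its value `1` at `w_a = 1` does not change the
coefficients: the difference quotient is a combination of terms without coefficient at `n`. -/
lemma vanishing_interaction {S : Finset ι} {a : ι} {n : ι → ℤ} (haS : a ∈ S)
    (hn : ∀ j ∈ S, j ≠ a → n j < n a) (A : Finset ι) (hA : A ⊆ S.erase a) :
    Vanishing R S a n (fun w => interaction b A w
      * ((∏ l ∈ A, ratio b (w a) (w l)) - 1) * (1 / (1 - w a))) := by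
  induction A using Finset.induction_on_max with
  | empty =>
    simp only [Finset.prod_empty, sub_self, mul_zero, zero_mul]
    exact ⟨continuousOn_const, fun Ψ _ _ => by simp⟩
  | insert c A hc ih =>
    have hcA : c ∉ A := fun h => lt_irrefl c (hc c h)
    have hcS : c ∈ S.erase a := hA (Finset.mem_insert_self c A)
    have hAS : A ⊆ S.erase a := (Finset.subset_insert c A).trans hA
    have hca : c ≠ a := Finset.ne_of_mem_erase hcS
    have hla : ∀ l ∈ A, l ≠ a := fun l hl => Finset.ne_of_mem_erase (hAS hl)
    have h3 := (ih hAS).mul (PolyHol.prod A fun l _ => polyHol_ratio hb0 hR0 hR l c)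
      fun w ζ => by
        refine Finset.prod_congr rfl fun l hl => ?_
        rw [Function.update_of_ne (hla l hl), Function.update_of_ne hca]
    have h4 := (vanishing_chain hb0 hR0 hR haS hn A hAS hcS hc).mul
      (Φ := fun w => b * w c - 1)
      (((polyHol_const _).mul (polyHol_coord c)).sub (polyHol_const 1)) fun w ζ => by
        rw [Function.update_of_ne hca]
    refine (h3.add hR0 h4).congr hR0 fun w hw => ?_
    rw [interaction_insert_max b hc, Finset.prod_insert hcA]
    simp only [Finset.prod_mul_distrib]
    have key : (ratio b (w a) (w c) - 1) * (1 / (1 - w a))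
        = (b * w c - 1) * (1 / den b (w a) (w c)) := by
      have d1 := den_ne_zero hb0 hR0 hR (hw a).le (hw c).le
      have d2 : 1 - w a ≠ 0 := by
        intro h
        have h1 := hw a
        rw [← sub_eq_zero.1 h, norm_one] at h1
        exact absurd h1 (inv_lt_one_of_one_lt₀ (one_lt_radius hb0 hR0 hR)).ne'
      unfold ratio
      field_simp
      unfold den
      ring
    linear_combination (interaction b A w * (∏ l ∈ A, ratio b (w a) (w l))
      * ∏ l ∈ A, ratio b (w l) (w c)) * key

/-- All coefficients of `interaction · ∏ 1 / (1 - w_i)` at strictly decreasing exponents are `1`. -/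
lemma integral_interaction_of_strictAntiOn (S : Finset ι) {n : ι → ℤ}
    (hn : StrictAntiOn n S) (hn0 : ∀ i ∈ S, 0 ≤ n i) :
    ∫ w, interaction b S w * (∏ i ∈ S, 1 / (1 - w i)) * monom S n w ∂torusLaw ι R = 1 := by
  induction S using Finset.induction_on_min with
  | empty => simp [interaction, monom]
  | insert a S ha ih =>
    have haS : a ∉ S := fun h => lt_irrefl a (ha a h)
    have hsub : S ⊆ (insert a S).erase a := by rw [Finset.erase_insert haS]
    have hlt : ∀ j ∈ insert a S, j ≠ a → n j < n a := by
      intro j hj hja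
      have hjS := Finset.mem_of_mem_insert_of_ne hj hja
      exact hn (by simp) (by simp [hjS]) (ha j hjS)
    have hG : PolyHol R (fun w : ι → ℂ => ∏ i ∈ S, 1 / (1 - w i)) :=
      PolyHol.prod S fun i _ => polyHol_geometric hb0 hR0 hR i
    have hGa : ∀ (w : ι → ℂ) ζ, ∏ i ∈ S, 1 / (1 - Function.update w a ζ i)
        = ∏ i ∈ S, 1 / (1 - w i) := fun w ζ => by
      refine Finset.prod_congr rfl fun i hi => ?_
      rw [Function.update_of_ne (ne_of_mem_of_not_mem hi haS)]
    have hV := vanishing_interaction hb0 hR0 hR (Finset.mem_insert_self a S) hlt S hsub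
    have h1 : ∀ w ∈ torus ι R, interaction b (insert a S) w
        * (∏ i ∈ insert a S, 1 / (1 - w i)) * monom (insert a S) n w
        = interaction b S w * (∏ i ∈ S, 1 / (1 - w i)) * (1 / (1 - w a)) * monom (insert a S) n w
        + interaction b S w * ((∏ l ∈ S, ratio b (w a) (w l)) - 1) * (1 / (1 - w a))
          * (∏ i ∈ S, 1 / (1 - w i)) * monom (insert a S) n w := by
      intro w _
      rw [interaction_insert_min b ha, Finset.prod_insert haS]
      ring
    have hc := continuousOn_monom (ι := ι) hR0 (insert a S) n
    have hI := polyHol_interaction (ι := ι) hb0 hR0 hR S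
    rw [integral_torusLaw_congr hR0 h1, integral_add, hV.2 _ hG hGa, add_zero,
      integral_geometric_mul_monom (one_lt_radius hb0 hR0 hR) (hI.mul hG).continuousOn
        (Finset.mem_insert_self a S) (fun w ζ => by rw [hGa, interaction_update b haS])
        (hn0 a (Finset.mem_insert_self a S)), Finset.erase_insert haS]
    · refine ih (hn.mono ?_) fun i hi => hn0 i (Finset.mem_insert_of_mem hi)
      exact_mod_cast Finset.subset_insert a S
    · exact integrable_of_continuousOn hR0 (((hI.mul hG).mul
        (polyHol_geometric hb0 hR0 hR a)).continuousOn.fun_mul hc)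
    · exact integrable_of_continuousOn hR0 ((hV.1.fun_mul hG.continuousOn).fun_mul hc)

/-- Coefficients with a negative exponent vanish. -/
lemma integral_interaction_of_neg (S : Finset ι) {n : ι → ℤ} {i : ι} (hi : i ∈ S) (hn : n i < 0) :
    ∫ w, interaction b S w * (∏ i ∈ S, 1 / (1 - w i)) * monom S n w ∂torusLaw ι R = 0 :=
  integral_mul_monom_of_neg hR0 ((polyHol_interaction hb0 hR0 hR S).mul
    (PolyHol.prod S fun i _ => polyHol_geometric hb0 hR0 hR i)) hi hn

end Interaction

/-! ### Boundary conditions for the contour integrals -/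

section Boundary

/-- The factor which a geometric sum over the shifts `c, c + 1, ...` of the position of particle
`l` produces in an integral over the variables of `S`. -/
def shiftFactor {ι : Type*} [DecidableEq ι] (b : ℝ) (S : Finset ι) (l : ι) (c : ℕ) (w : ι → ℂ) :
    ℂ :=
  if l ∈ S then w l ^ c / (1 - b * w l) else 1 / (1 - (b : ℂ))

/-- Summing a geometric progression of shifts of one position inside an integral. -/
lemma hasSum_integral_shift {ι : Type*} [Fintype ι] [DecidableEq ι] {b R : ℝ} (hb0 : 0 < b)
    (hb1 : b < 1) (hR : 1 < R) {F : (ι → ℂ) → ℂ} (hF : ContinuousOn F (torus ι R))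
    (S : Finset ι) (l : ι) (y : ι → ℕ) (c : ℕ) :
    HasSum (fun j : ℕ => (b : ℂ) ^ j * ∫ w, F w *
        ∏ i ∈ S, w i ^ (Function.update y l (y l + c + j) i) ∂torusLaw ι R)
      (∫ w, F w * (∏ i ∈ S, w i ^ y i) * shiftFactor b S l c w ∂torusLaw ι R) := by
  have hR0 : 0 < R := by linarith
  have hR1 : R⁻¹ < 1 := inv_lt_one_of_one_lt₀ hR
  obtain ⟨C, hC⟩ := (isCompact_torus (ι := ι) R).exists_bound_of_continuousOn hF
  have hmon : ∀ y : ι → ℕ, ContinuousOn (fun w : ι → ℂ => ∏ i ∈ S, w i ^ y i) (torus ι R) :=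
    fun y => (continuous_finsetProd S fun i _ => (continuous_apply i).pow _).continuousOn
  simp_rw [← integral_const_mul]
  refine hasSum_integral_torusLaw hR0 (β := fun j => b ^ j * C) (fun j => ?_) ?_ ?_ ?_
  · exact continuousOn_const.fun_mul (hF.fun_mul (hmon _))
  · exact (summable_geometric_of_lt_one hb0.le hb1).mul_right C
  · intro j w hw
    rw [norm_mul, norm_mul, norm_pow, Complex.norm_real, Real.norm_of_nonneg hb0.le]
    gcongr
    refine (mul_le_of_le_one_right (norm_nonneg _) ?_).trans (hC w hw)
    rw [norm_prod]
    refine Finset.prod_le_one (fun _ _ => norm_nonneg _) fun i _ => ?_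
    rw [norm_pow, hw i]
    exact pow_le_one₀ (by positivity) hR1.le
  · intro w hw
    by_cases hl : l ∈ S
    · simp only [shiftFactor, if_pos hl]
      have h1 : ‖(b : ℂ) * w l‖ < 1 := by
        rw [norm_mul, hw l, Complex.norm_real, Real.norm_of_nonneg hb0.le]
        exact mul_lt_one_of_nonneg_of_lt_one_left hb0.le hb1 hR1.le
      have h2 : HasSum (fun j : ℕ => F w * (∏ i ∈ S, w i ^ y i) * w l ^ c * (b * w l) ^ j)
          (F w * (∏ i ∈ S, w i ^ y i) * w l ^ c * (1 - b * w l)⁻¹) :=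
        (hasSum_geometric_of_norm_lt_one h1).mul_left _
      have h3 : ∀ j : ℕ, ∏ i ∈ S, w i ^ (Function.update y l (y l + c + j) i)
          = (∏ i ∈ S, w i ^ y i) * w l ^ (c + j) := by
        intro j
        rw [← Finset.mul_prod_erase S _ hl, ← Finset.mul_prod_erase S (fun i => w i ^ y i) hl,
          Function.update_self, Finset.prod_congr rfl fun i hi => by
            rw [Function.update_of_ne (Finset.ne_of_mem_erase hi)]]
        ring
      simp only [h3]
      convert h2 using 1
      · ext j; ring
      · ring
    · simp only [shiftFactor, if_neg hl]
      have h1 : ‖(b : ℂ)‖ < 1 := by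
        rwa [Complex.norm_real, Real.norm_of_nonneg hb0.le]
      have h2 : HasSum (fun j : ℕ => F w * (∏ i ∈ S, w i ^ y i) * (b : ℂ) ^ j)
          (F w * (∏ i ∈ S, w i ^ y i) * (1 - (b : ℂ))⁻¹) :=
        (hasSum_geometric_of_norm_lt_one h1).mul_left _
      have h3 : ∀ j : ℕ, ∏ i ∈ S, w i ^ (Function.update y l (y l + c + j) i)
          = ∏ i ∈ S, w i ^ y i := fun j => Finset.prod_congr rfl fun i hi => by
        rw [Function.update_of_ne (ne_of_mem_of_not_mem hi hl)]
      simp only [h3]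
      convert h2 using 1
      · ext j; ring
      · ring

section Swap

variable {N : ℕ} {b : ℝ} {l l' : Fin N}

/-- `interaction` without the factor of the adjacent pair `l < l'`. -/
def interactionErase (b : ℝ) (l l' : Fin N) (S : Finset (Fin N)) (w : Fin N → ℂ) : ℂ :=
  ∏ i ∈ S, ∏ j ∈ S, if i < j ∧ ¬(i = l ∧ j = l') then ratio b (w i) (w j) else 1

lemma interaction_eq_mul_erase (b : ℝ) (hl : l < l') (S : Finset (Fin N)) (w : Fin N → ℂ) :
    interaction b S w = interactionErase b l l' S w
      * if l ∈ S ∧ l' ∈ S then ratio b (w l) (w l') else 1 := by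
  have h1 : ∏ i ∈ S, ∏ j ∈ S, (if i = l then (if j = l' then ratio b (w i) (w j) else 1) else 1)
      = if l ∈ S ∧ l' ∈ S then ratio b (w l) (w l') else 1 := by
    by_cases h : l ∈ S <;> by_cases h' : l' ∈ S <;>
      simp [Finset.prod_ite_irrel, Finset.prod_ite_eq', h, h']
  rw [← h1, interactionErase, ← Finset.prod_mul_distrib]
  refine Finset.prod_congr rfl fun i _ => ?_
  rw [← Finset.prod_mul_distrib]
  refine Finset.prod_congr rfl fun j _ => ?_
  by_cases hi : i = l
  · by_cases hj : j = l'
    · subst hi hj; simp [hl]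
    · simp [hi, hj]
  · simp [hi]

lemma swap_lt_swap_iff (hl : l.1 + 1 = l'.1) (i j : Fin N) :
    (Equiv.swap l l' i < Equiv.swap l l' j ∧ ¬(Equiv.swap l l' i = l ∧ Equiv.swap l l' j = l'))
      ↔ (i < j ∧ ¬(i = l ∧ j = l')) := by
  simp only [Equiv.swap_apply_def, Fin.lt_def, Fin.ext_iff]
  split_ifs <;> omega

lemma interactionErase_swap (b : ℝ) (hl : l.1 + 1 = l'.1) (S : Finset (Fin N)) (w : Fin N → ℂ) :
    interactionErase b l l' (S.map (Equiv.swap l l').toEmbedding) (fun i => w (Equiv.swap l l' i))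
      = interactionErase b l l' S w := by
  simp only [interactionErase, Finset.prod_map, Equiv.coe_toEmbedding, Equiv.swap_apply_self,
    swap_lt_swap_iff hl]

lemma kappa_map_swap (S : Finset (Fin N)) (hl : l.1 + 1 = l'.1) :
    kappa (S.map (Equiv.swap l l').toEmbedding) + (if l' ∈ S then 1 else 0)
      = kappa S + if l ∈ S then 1 else 0 := by
  have hne : l ≠ l' := by intro h; rw [h] at hl; omega
  rw [← Finset.sum_ite_eq' S l' (fun _ => 1), ← Finset.sum_ite_eq' S l (fun _ => 1), kappa, kappa,
    Finset.sum_map, ← Finset.sum_add_distrib, ← Finset.sum_add_distrib]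
  refine Finset.sum_congr rfl fun i _ => ?_
  simp only [Equiv.coe_toEmbedding, Equiv.swap_apply_def]
  by_cases h1 : i = l
  · subst h1; simp [hne, ← hl]
  · by_cases h2 : i = l'
    · subst h2; simp [hne.symm, ← hl]
    · simp [h1, h2]

end Swap

variable {N : ℕ}

/-- A family of functions on the torus, indexed by sets of particles, is a symmetric weight if it
is continuous and does not change under permutations of the particles. -/
structure IsSymmWeight (R : ℝ) (Q : Finset (Fin N) → (Fin N → ℂ) → ℂ) : Prop where
  continuousOn : ∀ S, ContinuousOn (Q S) (torus (Fin N) R)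
  map_equiv : ∀ (e : Equiv.Perm (Fin N)) S w,
    Q (S.map e.toEmbedding) w = Q S fun i => w (e i)

/-- The sum over all sets `S` of `k` particles of `b ^ κ(S)` times the integral in which the
interaction factor is weighted by `Q`; the positions `y` need not be ordered. -/
def setSum (b R : ℝ) (Q : Finset (Fin N) → (Fin N → ℂ) → ℂ) (k : ℕ) (y : Fin N → ℕ) : ℂ :=
  ∑ S ∈ (Finset.univ : Finset (Fin N)).powersetCard k, (b : ℂ) ^ kappa S *
    ∫ w, interaction b S w * Q S w * ∏ i ∈ S, w i ^ y i ∂torusLaw (Fin N) R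

section BC

variable {b R : ℝ} (hb0 : 0 < b) (hb1 : b < 1) (hR0 : 0 < R) (hR : 1 + b + b / R < R)
  {Q : Finset (Fin N) → (Fin N → ℂ) → ℂ} (hQ : IsSymmWeight R Q)

include hb0 hb1 hR0 hR hQ

omit hb1 in
lemma continuousOn_interaction_mul (S : Finset (Fin N)) :
    ContinuousOn (fun w => interaction b S w * Q S w) (torus (Fin N) R) :=
  (polyHol_interaction hb0 hR0 hR S).continuousOn.fun_mul (hQ.continuousOn S)

lemma hasSum_setSum (l : Fin N) (k : ℕ) (y : Fin N → ℕ) (c : ℕ) :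
    HasSum (fun j : ℕ => (b : ℂ) ^ j * setSum b R Q k (Function.update y l (y l + c + j)))
      (∑ S ∈ (Finset.univ : Finset (Fin N)).powersetCard k, (b : ℂ) ^ kappa S *
        ∫ w, interaction b S w * Q S w * (∏ i ∈ S, w i ^ y i) *
          shiftFactor b S l c w ∂torusLaw (Fin N) R) := by
  have h := hasSum_sum (s := (Finset.univ : Finset (Fin N)).powersetCard k) fun S _ =>
    (hasSum_integral_shift hb0 hb1 (one_lt_radius hb0 hR0 hR)
      (continuousOn_interaction_mul hb0 hR0 hR hQ S) S l y c).mul_left ((b : ℂ) ^ kappa S)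
  have e : (fun j : ℕ => (b : ℂ) ^ j * setSum b R Q k (Function.update y l (y l + c + j)))
      = fun j : ℕ => ∑ S ∈ (Finset.univ : Finset (Fin N)).powersetCard k, (b : ℂ) ^ kappa S *
        ((b : ℂ) ^ j * ∫ w, interaction b S w * Q S w *
          ∏ i ∈ S, w i ^ (Function.update y l (y l + c + j) i) ∂torusLaw (Fin N) R) := by
    ext j
    rw [setSum, Finset.mul_sum]
    exact Finset.sum_congr rfl fun S _ => by ring
  rw [e]
  exact h

omit hQ in
lemma one_sub_mul_ne_zero {w : Fin N → ℂ} (hw : w ∈ torus (Fin N) R) (i : Fin N) :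
    1 - (b : ℂ) * w i ≠ 0 := by
  intro h
  have h1 : ‖(b : ℂ) * w i‖ = 1 := by rw [← sub_eq_zero.1 h, norm_one]
  rw [norm_mul, hw i, Complex.norm_real, Real.norm_of_nonneg hb0.le] at h1
  have := inv_lt_one_of_one_lt₀ (one_lt_radius hb0 hR0 hR)
  have : b * R⁻¹ < 1 := mul_lt_one_of_nonneg_of_lt_one_left hb0.le hb1 this.le
  linarith

omit hQ in
lemma continuousOn_shiftFactor (i : Fin N) (c : ℕ) (S : Finset (Fin N)) :
    ContinuousOn (shiftFactor b S i c) (torus (Fin N) R) := by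
  unfold shiftFactor
  by_cases h : i ∈ S
  · simp only [if_pos h]
    exact ((continuous_apply i).continuousOn.pow c).div (continuousOn_const.sub
      (continuousOn_const.mul (continuous_apply i).continuousOn))
      fun w hw => one_sub_mul_ne_zero hb0 hb1 hR0 hR hw i
  · simp only [if_neg h]; exact continuousOn_const

/-- The boundary condition: exchanging the variables of two adjacent particles `l`, `l'` at the
same position shows that the contributions of `S` and of its image under the transposition
cancel. -/
lemma sum_integral_boundary {l l' : Fin N} (hl : l.1 + 1 = l'.1) (k : ℕ) {y : Fin N → ℕ}
    (hy : y l = y l') :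
    ∑ S ∈ (Finset.univ : Finset (Fin N)).powersetCard k, (b : ℂ) ^ kappa S *
        ∫ w, interaction b S w * Q S w * (∏ i ∈ S, w i ^ y i) *
          shiftFactor b S l 0 w ∂torusLaw (Fin N) R
      = ∑ S ∈ (Finset.univ : Finset (Fin N)).powersetCard k, (b : ℂ) ^ kappa S *
        ∫ w, interaction b S w * Q S w * (∏ i ∈ S, w i ^ y i) *
          shiftFactor b S l' 1 w ∂torusLaw (Fin N) R := by
  have hne : l ≠ l' := by intro h; rw [h] at hl; omega
  have hlt : l < l' := by rw [Fin.lt_def]; omega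
  set s := Equiv.swap l l' with hs
  set δ : Finset (Fin N) → (Fin N → ℂ) → ℂ := fun S w =>
    shiftFactor b S l 0 w - shiftFactor b S l' 1 w with hδ
  set T : Finset (Fin N) → (Fin N → ℂ) → ℂ := fun S w =>
    (b : ℂ) ^ kappa S * (interaction b S w * Q S w * (∏ i ∈ S, w i ^ y i) * δ S w) with hT
  have hm : ∀ S : Finset (Fin N), ContinuousOn (fun w : Fin N → ℂ => interaction b S w * Q S w *
      (∏ i ∈ S, w i ^ y i)) (torus (Fin N) R) := fun S =>
    (continuousOn_interaction_mul hb0 hR0 hR hQ S).fun_mul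
      (continuous_finsetProd S fun i _ => (continuous_apply i).pow _).continuousOn
  have hswap : ∀ S, ∀ w ∈ torus (Fin N) R,
      T (S.map s.toEmbedding) (fun i => w (s i)) = -T S w := by
    intro S w hw
    have h1 : ∏ i ∈ S.map s.toEmbedding, w (s i) ^ y i = ∏ i ∈ S, w i ^ y i := by
      rw [Finset.prod_map]
      refine Finset.prod_congr rfl fun i _ => ?_
      have : y (s i) = y i := by
        rw [hs, Equiv.swap_apply_def]
        split_ifs with h h'
        · rw [h, hy]
        · rw [h', hy]
        · rfl
      rw [Equiv.coe_toEmbedding, this]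
      simp [hs]
    have h2 : Q (S.map s.toEmbedding) (fun i => w (s i)) = Q S w := by
      rw [hQ.map_equiv]
      simp [hs]
    have hml : l ∈ S.map s.toEmbedding ↔ l' ∈ S := by
      rw [Finset.mem_map_equiv]; simp [hs]
    have hml' : l' ∈ S.map s.toEmbedding ↔ l ∈ S := by
      rw [Finset.mem_map_equiv]; simp [hs]
    have hk := kappa_map_swap S hl
    have hsl : s l = l' := Equiv.swap_apply_left l l'
    have hsl' : s l' = l := Equiv.swap_apply_right l l'
    simp only [hT, hδ, shiftFactor]
    rw [interaction_eq_mul_erase b hlt, interaction_eq_mul_erase b hlt,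
      interactionErase_swap b hl, h1, h2]
    simp only [hml, hml', hsl, hsl']
    rw [← hs] at hk
    have n1 := one_sub_mul_ne_zero hb0 hb1 hR0 hR hw l
    have n2 := one_sub_mul_ne_zero hb0 hb1 hR0 hR hw l'
    have n3 : (1 : ℂ) - b ≠ 0 := by
      rw [sub_ne_zero]; exact_mod_cast hb1.ne'
    have d1 := den_ne_zero hb0 hR0 hR (hw l).le (hw l').le
    have d2 := den_ne_zero hb0 hR0 hR (hw l').le (hw l).le
    by_cases hS : l ∈ S <;> by_cases hS' : l' ∈ S
    · simp only [hS, hS', if_true, and_self, add_left_inj] at hk ⊢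
      rw [hk]
      -- The difference of the shift factors of `l` and `l'` has the numerator `den b (w l) (w l')`,
      -- which cancels the denominator of the two-body factor and leaves `± (w l - w l')`.
      have key : ratio b (w l') (w l) * (w l' ^ 0 / (1 - b * w l') - w l ^ 1 / (1 - b * w l))
          = -(ratio b (w l) (w l')
            * (w l ^ 0 / (1 - b * w l) - w l' ^ 1 / (1 - b * w l'))) := by
        unfold ratio
        rw [pow_zero, pow_zero, pow_one, pow_one, div_sub_div _ _ n1 n2, div_sub_div _ _ n2 n1,
          div_mul_div_comm, div_mul_div_comm, ← neg_div, div_eq_div_iff (by positivity)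
          (by positivity)]
        unfold den
        ring
      linear_combination ((b : ℂ) ^ kappa S * interactionErase b l l' S w * Q S w
        * ∏ i ∈ S, w i ^ y i) * key
    · simp only [hS, hS', if_true, if_false, and_false, and_true, add_zero] at hk ⊢
      rw [hk, pow_succ]
      have key : b * (1 / (1 - (b : ℂ)) - w l ^ 1 / (1 - b * w l))
          = -(w l ^ 0 / (1 - b * w l) - 1 / (1 - (b : ℂ))) := by
        field_simp
        ring
      linear_combination ((b : ℂ) ^ kappa S * interactionErase b l l' S w * Q S w
        * ∏ i ∈ S, w i ^ y i) * key
    · simp only [hS, hS', if_true, if_false, and_false, and_true, add_zero] at hk ⊢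
      rw [← hk, pow_succ]
      have key : (w l' ^ 0 / (1 - b * w l') - 1 / (1 - (b : ℂ)))
          = -(b * (1 / (1 - (b : ℂ)) - w l' ^ 1 / (1 - b * w l'))) := by
        field_simp
        ring
      linear_combination ((b : ℂ) ^ kappa (S.map s.toEmbedding) * interactionErase b l l' S w
        * Q S w * ∏ i ∈ S, w i ^ y i) * key
    · simp [hS, hS']
  have hneg : ∀ S, ∫ w, T (S.map s.toEmbedding) w ∂torusLaw (Fin N) R
      = -∫ w, T S w ∂torusLaw (Fin N) R := by
    intro S
    rw [← integral_torusLaw_comp_equiv R s, integral_torusLaw_congr hR0 (hswap S), integral_neg]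
  have hsum : ∑ S ∈ (Finset.univ : Finset (Fin N)).powersetCard k,
      ∫ w, T S w ∂torusLaw (Fin N) R = 0 := by
    have h1 : ∑ S ∈ (Finset.univ : Finset (Fin N)).powersetCard k,
        ∫ w, T (S.map s.toEmbedding) w ∂torusLaw (Fin N) R
        = ∑ S ∈ (Finset.univ : Finset (Fin N)).powersetCard k, ∫ w, T S w ∂torusLaw (Fin N) R := by
      refine Finset.sum_equiv s.finsetCongr (fun S => ?_) fun S _ => ?_
      · simp [Finset.mem_powersetCard]
      · simp [Equiv.finsetCongr_apply]
    simp only [hneg, Finset.sum_neg_distrib] at h1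
    exact self_eq_neg.1 h1.symm
  rw [← sub_eq_zero, ← Finset.sum_sub_distrib, ← hsum]
  refine Finset.sum_congr rfl fun S _ => ?_
  rw [← mul_sub, ← integral_sub, ← integral_const_mul]
  · simp only [hT, hδ, mul_sub]
  · exact integrable_of_continuousOn hR0 ((hm S).fun_mul
      (continuousOn_shiftFactor hb0 hb1 hR0 hR l 0 S))
  · exact integrable_of_continuousOn hR0 ((hm S).fun_mul
      (continuousOn_shiftFactor hb0 hb1 hR0 hR l' 1 S))

end BC

end Boundary

/-! ### The generator on functions satisfying the boundary conditions -/

section Jump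

variable {N : ℕ} {b : ℝ}

/-- `Activated` for an arbitrary new vector of positions. -/
def ActivatedRaw (i : Fin N) (x : State N) (x' : Fin N → ℕ) (l : Fin N) : Prop :=
  i ≤ l ∧ ∀ j : Fin N, i ≤ j → j < l → ((x' j : ℕ) : ℕ∞) = next x j

open Classical in
/-- `jumpProb` for an arbitrary new vector of positions. -/
def jumpWeight (b : ℝ) (i : Fin N) (x : State N) (x' : Fin N → ℕ) : ℝ :=
  ∏ l : Fin N,
    if ActivatedRaw i x x' l then stepProb b (x.1 l) (next x l) (x' l)
    else if x' l = x.1 l then 1 else 0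

lemma next_eq_coe (x : State N) {l l' : Fin N} (hl : l.1 + 1 = l'.1) :
    next x l = (x.1 l' : ℕ∞) := by
  have h : l.1 + 1 < N := hl ▸ l'.2
  have h' : (⟨l.1 + 1, h⟩ : Fin N) = l' := Fin.ext hl
  rw [next, dif_pos h, h']

lemma next_eq_top (x : State N) {l : Fin N} (hl : l.1 + 1 = N) : next x l = ⊤ := by
  rw [next, dif_neg (by omega)]

lemma activatedRaw_self (i : Fin N) (x : State N) (x' : Fin N → ℕ) : ActivatedRaw i x x' i :=
  ⟨le_rfl, fun _ h h' => absurd h' h.not_gt⟩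

lemma jumpWeight_eq_zero_of_lt {i l : Fin N} (hl : l < i) {x : State N} {x' : Fin N → ℕ}
    (h : x' l ≠ x.1 l) : jumpWeight b i x x' = 0 := by
  refine Finset.prod_eq_zero (Finset.mem_univ l) ?_
  rw [if_neg fun h' => absurd h'.1 hl.not_ge, if_neg h]

open Classical in
/-- If the activated particle `i` does not push its neighbour, nothing else moves. -/
lemma jumpWeight_of_ne_next {i : Fin N} {x : State N} {x' : Fin N → ℕ}
    (h : ((x' i : ℕ) : ℕ∞) ≠ next x i) : jumpWeight b i x x'
      = if ∀ l, l ≠ i → x' l = x.1 l then stepProb b (x.1 i) (next x i) (x' i) else 0 := by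
  have hna : ∀ l ∈ Finset.univ.erase i, (if ActivatedRaw i x x' l
      then stepProb b (x.1 l) (next x l) (x' l) else if x' l = x.1 l then 1 else 0)
      = if x' l = x.1 l then (1 : ℝ) else 0 := by
    intro l hl
    rw [if_neg]
    rintro ⟨h1, h2⟩
    exact h (h2 i le_rfl (lt_of_le_of_ne h1 (Finset.ne_of_mem_erase hl).symm))
  rw [jumpWeight, ← Finset.mul_prod_erase _ _ (Finset.mem_univ i), if_pos (activatedRaw_self _ _ _),
    Finset.prod_congr rfl hna, Finset.prod_ite_zero]
  simp

open Classical in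
/-- If the activated particle `i` pushes its neighbour `i'`, the remaining move is that of `i'`. -/
lemma jumpWeight_of_eq_next {i i' : Fin N} (hi : i.1 + 1 = i'.1) {x : State N} {x' : Fin N → ℕ}
    (h : x' i = x.1 i') : jumpWeight b i x x'
      = b ^ (x.1 i' - x.1 i - 1) * jumpWeight b i' x (Function.update x' i (x.1 i)) := by
  have hlt : i < i' := by rw [Fin.lt_def]; omega
  have hr : jumpWeight b i' x (Function.update x' i (x.1 i))
      = ∏ l ∈ Finset.univ.erase i, if ActivatedRaw i' x (Function.update x' i (x.1 i)) l
        then stepProb b (x.1 l) (next x l) (Function.update x' i (x.1 i) l)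
        else if Function.update x' i (x.1 i) l = x.1 l then 1 else 0 := by
    rw [jumpWeight, ← Finset.mul_prod_erase _ _ (Finset.mem_univ i),
      if_neg (fun h' => absurd h'.1 hlt.not_ge), Function.update_self, if_pos rfl, one_mul]
  rw [hr, jumpWeight, ← Finset.mul_prod_erase _ _ (Finset.mem_univ i),
    if_pos (activatedRaw_self _ _ _)]
  congr 1
  · rw [next_eq_coe x hi, stepProb, h, if_neg (fun h' => lt_irrefl _ h'.2), if_pos rfl]
  · refine Finset.prod_congr rfl fun l hl => ?_
    have hli := Finset.ne_of_mem_erase hl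
    rw [Function.update_of_ne hli]
    congr 1
    refine propext ⟨fun ⟨h1, h2⟩ => ⟨?_, fun j hj hjl => ?_⟩,
      fun ⟨h1, h2⟩ => ⟨?_, fun j hj hjl => ?_⟩⟩
    · have := lt_of_le_of_ne h1 hli.symm
      rw [Fin.lt_def] at this
      rw [Fin.le_def]; omega
    · rw [Function.update_of_ne (hlt.trans_le hj).ne']
      exact h2 j (hlt.le.trans hj) hjl
    · exact hlt.le.trans h1
    · by_cases hji : j = i
      · rw [hji, h, next_eq_coe x hi]
      · have h3 := h2 j (by
          have := lt_of_le_of_ne hj (Ne.symm hji)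
          rw [Fin.lt_def] at this
          rw [Fin.le_def]; omega) hjl
        rwa [Function.update_of_ne hji] at h3

/-- Only ordered configurations can be reached. -/
lemma strictMono_of_jumpWeight_ne_zero {i : Fin N} {x : State N} {x' : Fin N → ℕ}
    (h : jumpWeight b i x x' ≠ 0) : StrictMono x' := by
  have h1 : ∀ l, (ActivatedRaw i x x' l → x.1 l < x' l ∧ ((x' l : ℕ) : ℕ∞) ≤ next x l) ∧
      (¬ActivatedRaw i x x' l → x' l = x.1 l) := by
    intro l
    have h2 := (Finset.prod_ne_zero_iff.1 h) l (Finset.mem_univ l)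
    refine ⟨fun ha => ?_, fun ha => ?_⟩
    · rw [if_pos ha, stepProb] at h2
      have hx : ((x.1 l : ℕ) : ℕ∞) < next x l := by
        by_cases hl : l.1 + 1 < N
        · rw [next_eq_coe x (l' := ⟨l.1 + 1, hl⟩) rfl]
          exact_mod_cast x.2 (by rw [Fin.lt_def]; simp)
        · rw [next_eq_top x (by omega)]
          exact ENat.natCast_lt_top _
      split_ifs at h2 with h3 h4
      · exact ⟨h3.1, h3.2.le⟩
      · rw [← h4] at hx
        exact ⟨by exact_mod_cast hx, h4.le⟩
      · exact absurd rfl h2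
    · rw [if_neg ha] at h2
      by_contra h3
      exact h2 (if_neg h3)
  have hstep : ∀ l l' : Fin N, l.1 + 1 = l'.1 → x' l < x' l' := by
    intro l l' hl
    have hlt : l < l' := by rw [Fin.lt_def]; omega
    have hx : x.1 l < x.1 l' := x.2 hlt
    have hge : x.1 l' ≤ x' l' := by
      by_cases ha : ActivatedRaw i x x' l'
      · exact ((h1 l').1 ha).1.le
      · exact ((h1 l').2 ha).ge
    by_cases ha : ActivatedRaw i x x' l
    · obtain ⟨-, h3⟩ := (h1 l).1 ha
      rw [next_eq_coe x hl] at h3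
      have h3 : x' l ≤ x.1 l' := by exact_mod_cast h3
      rcases h3.lt_or_eq with h4 | h4
      · exact h4.trans_le hge
      · have ha' : ActivatedRaw i x x' l' := by
          refine ⟨ha.1.trans hlt.le, fun j hj hjl => ?_⟩
          rcases eq_or_ne j l with rfl | hne
          · rw [next_eq_coe x hl, h4]
          · refine ha.2 j hj ?_
            rw [Fin.lt_def] at hjl ⊢
            have := Fin.val_ne_of_ne hne
            omega
        rw [h4]
        exact ((h1 l').1 ha').1
    · rw [(h1 l).2 ha]
      exact hx.trans_le hge
  cases N with
  | zero => exact fun l => l.elim0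
  | succ n => exact Fin.strictMono_iff_lt_succ.2 fun l => hstep _ _ (by simp)

/-- The boundary conditions at the particles `l ≥ i`: when particle `l` stands on the position of
its right neighbour `l'`, a geometric jump `j ≥ 0` of `l` has the same effect as a geometric jump
`j ≥ 1` of `l'`. -/
def BoundaryFrom (b : ℝ) (i : Fin N) (f : (Fin N → ℕ) → ℝ) : Prop :=
  ∀ l l' : Fin N, l.1 + 1 = l'.1 → i ≤ l → ∀ y : Fin N → ℕ, y l = y l' →
    ∑' j : ℕ, b ^ j * f (Function.update y l (y l + j))
      = ∑' j : ℕ, b ^ j * f (Function.update y l' (y l' + 1 + j))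

lemma summable_pow_mul_of_bounded (hb0 : 0 < b) (hb1 : b < 1) {u : ℕ → ℝ} {C : ℝ}
    (hu : ∀ j, |u j| ≤ C) : Summable fun j => b ^ j * u j := by
  refine Summable.of_norm_bounded ((summable_geometric_of_lt_one hb0.le hb1).mul_right C)
    fun j => ?_
  rw [norm_mul, norm_pow, Real.norm_of_nonneg hb0.le, Real.norm_eq_abs]
  gcongr
  exact hu j

lemma update_injective_nat (x : Fin N → ℕ) (i : Fin N) (c : ℕ) :
    Function.Injective fun j : ℕ => Function.update x i (c + j) := by
  intro j j' h
  have := congrFun h i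
  simpa using this

lemma mem_range_update {x x' : Fin N → ℕ} {i : Fin N} (h : x i < x' i)
    (h' : ∀ l, l ≠ i → x' l = x l) :
    x' ∈ Set.range fun j : ℕ => Function.update x i (x i + 1 + j) := by
  refine ⟨x' i - x i - 1, ?_⟩
  ext l
  by_cases hl : l = i
  · subst hl; simp; omega
  · simp [hl, h' l hl]

lemma hasSum_jumpWeight_last (hb0 : 0 < b) (hb1 : b < 1) {i : Fin N} (hi : i.1 + 1 = N)
    (x : State N) {f : (Fin N → ℕ) → ℝ} {C : ℝ} (hf : ∀ x, |f x| ≤ C) :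
    HasSum (fun x' => jumpWeight b i x x' * f x')
      (∑' j : ℕ, b ^ j * ((1 - b) * f (Function.update x.1 i (x.1 i + 1 + j)))) := by
  classical
  have hne : ∀ x' : Fin N → ℕ, ((x' i : ℕ) : ℕ∞) ≠ next x i := fun x' => by
    rw [next_eq_top x hi]; exact ENat.natCast_ne_top _
  refine ((update_injective_nat x.1 i (x.1 i + 1)).hasSum_iff ?_).1 ?_
  · intro x' hx'
    rw [jumpWeight_of_ne_next (hne x')]
    split_ifs with h
    · rw [stepProb, if_neg (fun h' => hx' (mem_range_update h'.1 h)), if_neg (hne x'), zero_mul]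
    · rw [zero_mul]
  · have h1 : Summable fun j : ℕ =>
        b ^ j * ((1 - b) * f (Function.update x.1 i (x.1 i + 1 + j))) := by
      refine summable_pow_mul_of_bounded hb0 hb1 (C := (1 - b) * C) fun j => ?_
      rw [abs_mul, abs_of_pos (by linarith : 0 < 1 - b)]
      exact mul_le_mul_of_nonneg_left (hf _) (by linarith)
    convert h1.hasSum using 1
    ext j
    rw [Function.comp_apply, jumpWeight_of_ne_next (hne _), if_pos fun l hl => by
      rw [Function.update_of_ne hl], stepProb, if_pos ⟨by simp; omega, by
        rw [next_eq_top x hi]; exact ENat.natCast_lt_top _⟩, Function.update_self]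
    have : x.1 i + 1 + j - x.1 i - 1 = j := by omega
    rw [this]
    ring

/-- By the boundary conditions the whole cascade started by particle `i` acts on `f` as a free
geometric jump of particle `i`. -/
lemma hasSum_jumpWeight (hb0 : 0 < b) (hb1 : b < 1) (i : Fin N) (x : State N)
    {f : (Fin N → ℕ) → ℝ} {C : ℝ} (hf : ∀ x, |f x| ≤ C) (hBC : BoundaryFrom b i f) :
    HasSum (fun x' => jumpWeight b i x x' * f x')
      (∑' j : ℕ, b ^ j * ((1 - b) * f (Function.update x.1 i (x.1 i + 1 + j)))) := by
  classical
  obtain ⟨d, hd⟩ : ∃ d, i.1 + 1 + d = N := ⟨N - (i.1 + 1), by omega⟩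
  induction d generalizing i f with
  | zero => exact hasSum_jumpWeight_last hb0 hb1 (by omega) x hf
  | succ d ih =>
    set i' : Fin N := ⟨i.1 + 1, by omega⟩ with hi'
    have hii : i.1 + 1 = i'.1 := rfl
    have hlt : i < i' := by rw [Fin.lt_def]; omega
    have hx : x.1 i < x.1 i' := x.2 hlt
    obtain ⟨g, hg⟩ : ∃ g, x.1 i' = x.1 i + 1 + g := ⟨x.1 i' - x.1 i - 1, by omega⟩
    set f' : (Fin N → ℕ) → ℝ := fun x' => f (Function.update x' i (x.1 i')) with hf'
    -- the particle stops before its neighbour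
    set P₁ : (Fin N → ℕ) → ℝ := fun x' => if x' i = x.1 i' then 0 else jumpWeight b i x x' * f x'
      with hP₁
    -- the particle pushes its neighbour
    set P₂ : (Fin N → ℕ) → ℝ := fun x' => if x' i = x.1 i' then jumpWeight b i x x' * f x' else 0
      with hP₂
    have hsplit : (fun x' => jumpWeight b i x x' * f x') = fun x' => P₁ x' + P₂ x' := by
      ext x'
      simp only [hP₁, hP₂]
      split_ifs <;> simp
    have hne : ∀ x' : Fin N → ℕ, x' i ≠ x.1 i' → ((x' i : ℕ) : ℕ∞) ≠ next x i := fun x' h => by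
      rw [next_eq_coe x hii]; exact_mod_cast h
    have h₁ : HasSum P₁ (∑ j ∈ Finset.range g,
        b ^ j * ((1 - b) * f (Function.update x.1 i (x.1 i + 1 + j)))) := by
      refine ((update_injective_nat x.1 i (x.1 i + 1)).hasSum_iff ?_).1 ?_
      · intro x' hx'
        simp only [hP₁]
        split_ifs with h
        · rfl
        · rw [jumpWeight_of_ne_next (hne x' h)]
          split_ifs with h2
          · rw [stepProb, if_neg (fun h' => hx' (mem_range_update h'.1 h2)), if_neg (hne x' h),
              zero_mul]
          · rw [zero_mul]
      · have h2 : ∀ j : ℕ, (P₁ ∘ fun j => Function.update x.1 i (x.1 i + 1 + j)) j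
            = if j < g then b ^ j * ((1 - b) * f (Function.update x.1 i (x.1 i + 1 + j)))
              else 0 := by
          intro j
          simp only [hP₁, Function.comp_apply, Function.update_self]
          by_cases h : x.1 i + 1 + j = x.1 i'
          · rw [if_pos h, if_neg (by omega)]
          · have h3 := hne (Function.update x.1 i (x.1 i + 1 + j)) (by simpa using h)
            rw [if_neg h, jumpWeight_of_ne_next h3, if_pos fun l hl => by
              rw [Function.update_of_ne hl], stepProb]
            rw [Function.update_self] at h3 ⊢
            by_cases hj : j < g
            · rw [if_pos hj, if_pos ⟨by omega, by
                rw [next_eq_coe x hii]; exact_mod_cast (by omega : x.1 i + 1 + j < x.1 i')⟩]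
              have : x.1 i + 1 + j - x.1 i - 1 = j := by omega
              rw [this]
              ring
            · rw [if_neg hj, if_neg, if_neg h3, zero_mul]
              rintro ⟨-, h4⟩
              rw [next_eq_coe x hii] at h4
              have h4 : x.1 i + 1 + j < x.1 i' := by exact_mod_cast h4
              omega
        have h3 := hasSum_sum_of_ne_finset_zero (L := SummationFilter.unconditional ℕ)
          (s := Finset.range g)
          (f := P₁ ∘ fun j => Function.update x.1 i (x.1 i + 1 + j)) fun j hj => by
            rw [h2, if_neg (by simpa using hj)]
        rwa [Finset.sum_congr rfl fun j hj => by
          rw [h2, if_pos (Finset.mem_range.1 hj)]] at h3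
    have h₂ : HasSum P₂ (b ^ g *
        ∑' j : ℕ, b ^ j * ((1 - b) * f' (Function.update x.1 i' (x.1 i' + 1 + j)))) := by
      have hBC' : BoundaryFrom b i' f' := by
        intro l l' hl hil y hy
        have hli : l ≠ i := (hlt.trans_le hil).ne'
        have hl'i : l' ≠ i := by
          intro h; rw [h] at hl; rw [Fin.le_def] at hil; omega
        have h := hBC l l' hl (hlt.le.trans hil) (Function.update y i (x.1 i'))
          (by rwa [Function.update_of_ne hli, Function.update_of_ne hl'i])
        simp only [Function.update_of_ne hli, Function.update_of_ne hl'i] at h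
        simp only [hf']
        simpa only [Function.update_comm hli.symm, Function.update_comm hl'i.symm] using h
      have h3 := (ih i' (f := f') (fun x' => hf _) hBC' (by omega)).mul_left (b ^ g)
      -- A pushing particle ends at the position of its neighbour, whereas the move of the neighbour
      -- alone leaves it in place; exchanging these two positions matches the two sums.
      have hinv : Function.Involutive fun x' : Fin N → ℕ =>
          Function.update x' i (Equiv.swap (x.1 i) (x.1 i') (x' i)) := by
        intro x'
        simp
      refine hinv.toPerm.hasSum_iff.1 ?_
      refine (congrArg (HasSum · _) (funext fun x' => ?_)).mpr h3
      simp only [Function.comp_apply, Function.Involutive.coe_toPerm, hP₂, hf',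
        Function.update_self]
      by_cases h : x' i = x.1 i
      · rw [h, Equiv.swap_apply_left, if_pos rfl, jumpWeight_of_eq_next hii (by simp),
          Function.update_idem, ← h, Function.update_eq_self, h]
        have : x.1 i' - x.1 i - 1 = g := by omega
        rw [this]
        ring
      · rw [if_neg, jumpWeight_eq_zero_of_lt hlt h, zero_mul, mul_zero]
        intro h4
        rw [Equiv.swap_apply_eq_iff, Equiv.swap_apply_right] at h4
        exact h h4
    rw [hsplit]
    convert h₁.add h₂ using 1
    have hsum : Summable fun j : ℕ =>
        b ^ j * ((1 - b) * f (Function.update x.1 i (x.1 i + 1 + j))) := by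
      refine summable_pow_mul_of_bounded hb0 hb1 (C := (1 - b) * C) fun j => ?_
      rw [abs_mul, abs_of_pos (by linarith : 0 < 1 - b)]
      exact mul_le_mul_of_nonneg_left (hf _) (by linarith)
    rw [← hsum.sum_add_tsum_nat_add g]
    congr 1
    have h := hBC i i' hii le_rfl (Function.update x.1 i (x.1 i'))
      (by rw [Function.update_self, Function.update_of_ne hlt.ne'])
    simp only [Function.update_self, Function.update_idem, Function.update_of_ne hlt.ne'] at h
    have h4 : ∀ j, f' (Function.update x.1 i' (x.1 i' + 1 + j)) = f (Function.update
        (Function.update x.1 i (x.1 i')) i' (x.1 i' + 1 + j)) := fun j => by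
      simp only [hf', Function.update_comm hlt.ne]
    have h5 : ∀ u : ℕ → ℝ, ∑' j, b ^ j * ((1 - b) * u j) = (1 - b) * ∑' j, b ^ j * u j := by
      intro u
      rw [← tsum_mul_left]
      exact tsum_congr fun j => by ring
    simp only [h4]
    rw [h5, ← h, ← mul_assoc, ← tsum_mul_left]
    refine tsum_congr fun j => ?_
    rw [hg, pow_add, show x.1 i + 1 + (j + g) = x.1 i + 1 + g + j by ring]
    ring

lemma hasSum_jumpProb (hb0 : 0 < b) (hb1 : b < 1) (i : Fin N) (x : State N)
    {f : (Fin N → ℕ) → ℝ} {C : ℝ} (hf : ∀ x, |f x| ≤ C) (hBC : BoundaryFrom b i f) :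
    HasSum (fun x' : State N => jumpProb b i x x' * f x'.1)
      (∑' j : ℕ, b ^ j * ((1 - b) * f (Function.update x.1 i (x.1 i + 1 + j)))) := by
  have h := hasSum_jumpWeight hb0 hb1 i x hf hBC
  rw [← hasSum_subtype_iff_of_support_subset (s := {x' | StrictMono x'})] at h
  · exact h
  · intro x' hx'
    exact strictMono_of_jumpWeight_ne_zero (left_ne_zero_of_mul hx')

/-- On functions which satisfy the boundary conditions the generator is that of independent
particles with geometric jumps. -/
lemma generator_eq_sum (hb0 : 0 < b) (hb1 : b < 1) (x : State N)
    {f : (Fin N → ℕ) → ℝ} {C : ℝ} (hf : ∀ x, |f x| ≤ C) (hBC : ∀ i, BoundaryFrom b i f) :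
    generator b (fun x : State N => f x.1) x
      = ∑ i, ((1 - b) * ∑' j : ℕ, b ^ j * f (Function.update x.1 i (x.1 i + 1 + j)) - f x.1) := by
  refine Finset.sum_congr rfl fun i _ => ?_
  have h1 := hasSum_jumpProb hb0 hb1 i x hf (hBC i)
  have h2 := hasSum_jumpProb hb0 hb1 i x (f := fun _ => 1) (C := 1) (by simp) (by
    intro l l' _ _ y _; rfl)
  have h3 : ∑' j : ℕ, b ^ j * ((1 - b) * 1) = 1 := by
    rw [tsum_mul_right, tsum_geometric_of_lt_one hb0.le hb1, mul_one,
      inv_mul_cancel₀ (by linarith)]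
  rw [h3] at h2
  simp only [mul_one] at h2
  have h4 := h1.sub (h2.mul_right (f x.1))
  simp only [← mul_sub, one_mul] at h4
  rw [h4.tsum_eq, ← tsum_mul_left]
  congr 1
  exact tsum_congr fun j => by ring

end Jump

/-! ### From the martingale problem to the exponential series of the generator -/

section Martingale

variable {Ω : Type*} {mΩ : MeasurableSpace Ω} {μ : Measure Ω} [IsProbabilityMeasure μ]
  {ℱ : Filtration ℝ≥0 mΩ} {N : ℕ} {b : ℝ} {y : State N} {X : ℝ≥0 → Ω → State N}

lemma integrable_comp_process (hX : IsProcess b y μ ℱ X) {f : State N → ℝ} {C : ℝ}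
    (hf : ∀ x, |f x| ≤ C) (ν : Measure ℝ) [IsFiniteMeasure ν] :
    Integrable (fun p : Ω × ℝ => f (X p.2.toNNReal p.1)) (μ.prod ν) := by
  refine Integrable.of_bound (C := C) ?_ (Eventually.of_forall fun p => by
    simpa using hf (X p.2.toNNReal p.1))
  have h1 : Measurable f := measurable_of_countable f
  exact (h1.comp (hX.measurable.comp
    ((measurable_real_toNNReal.comp measurable_snd).prodMk measurable_fst))).aestronglyMeasurable

lemma intervalIntegrable_expectation (hX : IsProcess b y μ ℱ X) {f : State N → ℝ} {C : ℝ}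
    (hf : ∀ x, |f x| ≤ C) (s t : ℝ) :
    IntervalIntegrable (fun s : ℝ => ∫ ω, f (X s.toNNReal ω) ∂μ) volume s t :=
  ⟨(integrable_comp_process hX hf (volume.restrict (Set.Ioc s t))).integral_prod_right,
    (integrable_comp_process hX hf (volume.restrict (Set.Ioc t s))).integral_prod_right⟩

/-- Dynkin's formula. -/
lemma expectation_eq_add_integral (hX : IsProcess b y μ ℱ X) {f g : State N → ℝ} {C D : ℝ}
    (hf : ∀ x, |f x| ≤ C) (hg : ∀ x, |g x| ≤ D) (hfg : ∀ x, generator b f x = g x) (t : ℝ≥0) :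
    ∫ ω, f (X t ω) ∂μ = f y + ∫ s in (0 : ℝ)..t, ∫ ω, g (X s.toNNReal ω) ∂μ := by
  have hM := hX.martingale f ⟨C, hf⟩
  have h1 := hM.setIntegral_eq (show (0 : ℝ≥0) ≤ t from t.coe_nonneg) MeasurableSet.univ
  simp only [hfg, Measure.restrict_univ, NNReal.coe_zero, intervalIntegral.integral_same,
    sub_zero] at h1
  have hint : Integrable (fun ω => f (X t ω)) μ := by
    refine Integrable.of_bound (C := C) ?_ (Eventually.of_forall fun ω => by simpa using hf (X t ω))
    have h2 : Measurable f := measurable_of_countable f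
    exact (h2.comp (hX.measurable.comp measurable_prodMk_left)).aestronglyMeasurable
  have hprod := integrable_comp_process hX hg (volume.restrict (Set.Ioc (0 : ℝ) t))
  have hint2 : Integrable (fun ω => ∫ s in (0 : ℝ)..t, g (X s.toNNReal ω)) μ := by
    simp only [intervalIntegral.integral_of_le t.coe_nonneg]
    exact hprod.integral_prod_left
  rw [integral_sub hint hint2] at h1
  have h3 : ∫ ω, f (X 0 ω) ∂μ = f y := by
    rw [integral_congr_ae (hX.initial.mono fun ω h => show f (X 0 ω) = f y by rw [h])]
    simp
  have h4 : ∫ ω, (∫ s in (0 : ℝ)..t, g (X s.toNNReal ω)) ∂μ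
      = ∫ s in (0 : ℝ)..t, ∫ ω, g (X s.toNNReal ω) ∂μ := by
    simp only [intervalIntegral.integral_of_le t.coe_nonneg]
    exact integral_integral_swap hprod
  rw [h3, h4] at h1
  linarith

lemma abs_expectation_sub_sum_le (hX : IsProcess b y μ ℱ X) {u : ℕ → State N → ℝ} {C K : ℝ}
    (hu : ∀ n x, |u n x| ≤ C * K ^ n) (hgen : ∀ n x, generator b (u n) x = u (n + 1) x)
    (p n : ℕ) (t : ℝ≥0) :
    |∫ ω, u n (X t ω) ∂μ - ∑ j ∈ Finset.range p, (t : ℝ) ^ j / j.factorial * u (n + j) y|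
      ≤ C * K ^ (n + p) * (t : ℝ) ^ p / p.factorial := by
  induction p generalizing n t with
  | zero =>
    simp only [Finset.range_zero, Finset.sum_empty, sub_zero, add_zero, pow_zero, mul_one,
      Nat.factorial_zero, Nat.cast_one, div_one]
    refine (abs_integral_le_integral_abs).trans ?_
    calc ∫ ω, |u n (X t ω)| ∂μ ≤ ∫ _, C * K ^ n ∂μ :=
          integral_mono_of_nonneg (Eventually.of_forall fun _ => abs_nonneg _)
            (integrable_const _) (Eventually.of_forall fun ω => hu n _)
      _ = _ := by simp
  | succ p ih =>
    have h1 := expectation_eq_add_integral hX (hu n) (hu (n + 1)) (hgen n) t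
    have hterm : ∀ j : ℕ, ∫ s in (0 : ℝ)..t, s ^ j / j.factorial * u (n + 1 + j) y
        = (t : ℝ) ^ (j + 1) / (j + 1).factorial * u (n + (j + 1)) y := by
      intro j
      rw [intervalIntegral.integral_mul_const, intervalIntegral.integral_div, integral_pow,
        Nat.factorial_succ, show n + 1 + j = n + (j + 1) by ring]
      push_cast
      have : ((j : ℝ) + 1) ≠ 0 := by positivity
      field_simp
      ring
    have hI : ∀ j ∈ Finset.range p, IntervalIntegrable
        (fun s : ℝ => s ^ j / j.factorial * u (n + 1 + j) y) volume 0 t := fun j _ =>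
      (by fun_prop : Continuous fun s : ℝ => s ^ j / j.factorial * u (n + 1 + j) y).intervalIntegrable
        _ _
    have hS : Continuous fun s : ℝ =>
        ∑ j ∈ Finset.range p, s ^ j / j.factorial * u (n + 1 + j) y := by
      fun_prop
    have h2 : ∑ j ∈ Finset.range (p + 1), (t : ℝ) ^ j / j.factorial * u (n + j) y
        = u n y + ∫ s in (0 : ℝ)..t,
          ∑ j ∈ Finset.range p, s ^ j / j.factorial * u (n + 1 + j) y := by
      rw [Finset.sum_range_succ', intervalIntegral.integral_finsetSum hI]
      simp only [hterm]
      simp [add_comm]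
    rw [h1, h2, add_sub_add_left_eq_sub, ← intervalIntegral.integral_sub
      (intervalIntegrable_expectation hX (hu (n + 1)) 0 t) (hS.intervalIntegrable _ _)]
    have h3 : ∀ s ∈ Set.Ioc (0 : ℝ) t, ‖∫ ω, u (n + 1) (X s.toNNReal ω) ∂μ
        - ∑ j ∈ Finset.range p, s ^ j / j.factorial * u (n + 1 + j) y‖
        ≤ C * K ^ (n + 1 + p) * s ^ p / p.factorial := by
      intro s hs
      have := ih (n + 1) s.toNNReal
      rwa [Real.coe_toNNReal s hs.1.le] at this
    have hB : IntervalIntegrable (fun s : ℝ => C * K ^ (n + 1 + p) * s ^ p / p.factorial)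
        volume 0 t := (by fun_prop : Continuous fun s : ℝ =>
        C * K ^ (n + 1 + p) * s ^ p / p.factorial).intervalIntegrable _ _
    have h4 := intervalIntegral.norm_integral_le_of_norm_le t.coe_nonneg
      (Eventually.of_forall h3) hB
    refine h4.trans (le_of_eq ?_)
    rw [intervalIntegral.integral_div, intervalIntegral.integral_const_mul, integral_pow,
      Nat.factorial_succ, show n + (p + 1) = n + 1 + p by ring]
    push_cast
    have : ((p : ℝ) + 1) ≠ 0 := by positivity
    field_simp
    ring

/-- If `u n` is the `n`-th iterate of the generator, with geometric bounds, then
`E (u 0 (X t)) = ∑ t ^ n / n! u n y`. -/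
lemma tendsto_sum_expectation (hX : IsProcess b y μ ℱ X) {u : ℕ → State N → ℝ} {C K : ℝ}
    (hu : ∀ n x, |u n x| ≤ C * K ^ n) (hgen : ∀ n x, generator b (u n) x = u (n + 1) x)
    (t : ℝ≥0) :
    Tendsto (fun p => ∑ j ∈ Finset.range p, (t : ℝ) ^ j / j.factorial * u j y) atTop
      (𝓝 (∫ ω, u 0 (X t ω) ∂μ)) := by
  rw [tendsto_iff_norm_sub_tendsto_zero]
  have h1 : Tendsto (fun p : ℕ => C * ((K * t) ^ p / p.factorial)) atTop (𝓝 0) := by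
    simpa using (FloorSemiring.tendsto_pow_div_factorial_atTop (K * (t : ℝ))).const_mul C
  refine squeeze_zero (fun _ => norm_nonneg _) (fun p => ?_) h1
  have h2 := abs_expectation_sub_sum_le hX hu hgen p 0 t
  simp only [zero_add] at h2
  rw [norm_sub_rev, Real.norm_eq_abs]
  refine h2.trans (le_of_eq ?_)
  rw [mul_pow]
  ring

end Martingale

/-! ### Gaussian binomial identities -/

section QBinom

lemma qBinom_zero_right (q : ℝ) (n : ℕ) : qBinom q n 0 = 1 := by simp [qBinom]

lemma qBinom_of_lt (q : ℝ) {n k : ℕ} (h : n < k) : qBinom q n k = 0 :=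
  Finset.prod_eq_zero (Finset.mem_range.2 h) (by simp)

lemma qBinom_succ_right (q : ℝ) (n k : ℕ) :
    qBinom q n (k + 1) = qBinom q n k * ((1 - q ^ (n - k)) / (1 - q ^ (k + 1))) :=
  Finset.prod_range_succ _ _

variable {b : ℝ} (hb0 : 0 < b) (hb1 : b < 1)

include hb0 hb1

lemma one_sub_pow_ne_zero (k : ℕ) : 1 - b ^ (k + 1) ≠ 0 :=
  (sub_pos.2 (pow_lt_one₀ hb0.le hb1 k.succ_ne_zero)).ne'

omit hb0 hb1 in
lemma qBinom_succ_succ (n k : ℕ) :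
    qBinom b (n + 1) (k + 1) = qBinom b n k * ((1 - b ^ (n + 1)) / (1 - b ^ (k + 1))) := by
  have h1 := Finset.prod_range_succ' (fun j => 1 - b ^ (n + 1 - j)) k
  have h2 := Finset.prod_range_succ (fun j => 1 - b ^ (j + 1)) k
  simp only [Nat.add_sub_add_right, Nat.sub_zero] at h1
  rw [qBinom, qBinom, Finset.prod_div_distrib, Finset.prod_div_distrib, h1, h2,
    mul_div_mul_comm]

lemma qBinom_self (n : ℕ) : qBinom b n n = 1 := by
  induction n with
  | zero => exact qBinom_zero_right b 0
  | succ n ih => rw [qBinom_succ_succ, ih, div_self (one_sub_pow_ne_zero hb0 hb1 n), one_mul]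

lemma qBinom_pascal (n k : ℕ) :
    qBinom b (n + 1) (k + 1) = qBinom b n k + b ^ (k + 1) * qBinom b n (k + 1) := by
  rcases lt_or_ge n k with h | h
  · simp [qBinom_of_lt b h, qBinom_of_lt b (show n + 1 < k + 1 by omega),
      qBinom_of_lt b (show n < k + 1 by omega)]
  · obtain ⟨d, rfl⟩ := Nat.exists_eq_add_of_le h
    have h0 := one_sub_pow_ne_zero hb0 hb1 k
    rw [qBinom_succ_succ, qBinom_succ_right, Nat.add_sub_cancel_left]
    field_simp
    ring

lemma qBinom_pascal' {n k : ℕ} (h : k ≤ n) :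
    qBinom b (n + 1) (k + 1) = b ^ (n - k) * qBinom b n k + qBinom b n (k + 1) := by
  obtain ⟨d, rfl⟩ := Nat.exists_eq_add_of_le h
  have h0 := one_sub_pow_ne_zero hb0 hb1 k
  rw [qBinom_succ_succ, qBinom_succ_right, Nat.add_sub_cancel_left]
  field_simp
  ring

lemma qBinom_succ_left_mul {n k : ℕ} :
    qBinom b (n + 1) k * (1 - b ^ (n + 1 - k)) = (1 - b ^ (n + 1)) * qBinom b n k := by
  have h0 := one_sub_pow_ne_zero hb0 hb1 k
  have h1 := qBinom_succ_succ (b := b) n k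
  rw [qBinom_succ_right] at h1
  field_simp at h1
  linarith

lemma qBinom_mul_qBinom (n m j : ℕ) :
    qBinom b n (m + j) * qBinom b (m + j) m = qBinom b n m * qBinom b (n - m) j := by
  induction j with
  | zero => rw [add_zero, qBinom_self hb0 hb1, qBinom_zero_right]
  | succ j ih =>
    have h0 := one_sub_pow_ne_zero hb0 hb1 (m + j)
    have h1 := one_sub_pow_ne_zero hb0 hb1 j
    have h2 := qBinom_succ_left_mul hb0 hb1 (n := m + j) (k := m)
    rw [show m + j + 1 - m = j + 1 by omega] at h2
    rw [← add_assoc, qBinom_succ_right, qBinom_succ_right, ← mul_assoc, ← ih,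
      show n - m - j = n - (m + j) by omega]
    field_simp
    linear_combination (qBinom b n (m + j) * (1 - b ^ (n - (m + j)))) * h2

lemma sum_neg_one_pow_mul_qBinom (M J : ℕ) :
    ∑ j ∈ Finset.range (J + 1), (-1) ^ j * b ^ (j.choose 2) * qBinom b (M + 1) j
      = (-1) ^ J * b ^ ((J + 1).choose 2) * qBinom b M J := by
  induction J with
  | zero => simp [qBinom_zero_right]
  | succ J ih =>
    rw [Finset.sum_range_succ, ih, qBinom_pascal hb0 hb1, Nat.choose_succ_succ' (J + 1) 1,
      Nat.choose_one_right, pow_add b (J + 1), pow_succ (-1 : ℝ)]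
    ring

/-- The alternating sum that combines the contributions of the sets of `k` particles, when exactly
`p` particles contribute, is the indicator of `m ≤ p` up to sign. -/
lemma sum_qBinom_mul_qBinom {m N p : ℕ} (hm : 1 ≤ m) (hp : p ≤ N) :
    (-1) ^ (m - 1) * b ^ (m.choose 2) * ∑ k ∈ Finset.Icc m N, (b ^ (m * k))⁻¹ * (-1) ^ k
        * qBinom b (k - 1) (m - 1) * (b ^ ((k + 1).choose 2) * qBinom b p k)
      = if m ≤ p then -1 else 0 := by
  obtain ⟨r, rfl⟩ := Nat.exists_eq_add_of_le' hm
  rw [Nat.add_sub_cancel]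
  induction p with
  | zero =>
    rw [Finset.sum_eq_zero, mul_zero, if_neg (by omega)]
    intro k hk
    have := Finset.mem_Icc.1 hk
    rw [qBinom_of_lt b (show 0 < k by omega)]
    ring
  | succ p ih =>
    have ih := ih (by omega)
    have hdiff : ∀ k ∈ Finset.Icc (r + 1) N, (b ^ ((r + 1) * k))⁻¹ * (-1) ^ k
        * qBinom b (k - 1) r * (b ^ ((k + 1).choose 2) * qBinom b (p + 1) k)
        = (b ^ ((r + 1) * k))⁻¹ * (-1) ^ k
          * qBinom b (k - 1) r * (b ^ ((k + 1).choose 2) * qBinom b p k)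
        + (b ^ ((r + 1) * k))⁻¹ * (-1) ^ k
          * qBinom b (k - 1) r * (b ^ ((k + 1).choose 2) * (b ^ (p + 1 - k)
            * qBinom b p (k - 1))) := by
      intro k hk
      obtain ⟨l, rfl⟩ : ∃ l, k = l + 1 := ⟨k - 1, by have := Finset.mem_Icc.1 hk; omega⟩
      rw [Nat.add_sub_cancel, Nat.add_sub_add_right]
      rcases lt_or_ge p l with h | h
      · simp [qBinom_of_lt b h, qBinom_of_lt b (show p + 1 < l + 1 by omega),
          qBinom_of_lt b (show p < l + 1 by omega)]
      · rw [qBinom_pascal' hb0 hb1 h]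
        ring
    rw [Finset.sum_congr rfl hdiff, Finset.sum_add_distrib, mul_add, ih]
    rcases lt_or_ge p r with h | h
    · rw [Finset.sum_eq_zero, mul_zero, if_neg (by omega), if_neg (by omega), add_zero]
      intro k hk
      have := Finset.mem_Icc.1 hk
      rw [qBinom_of_lt b (show p < k - 1 by omega)]
      ring
    obtain ⟨M, rfl⟩ := Nat.exists_eq_add_of_le h
    obtain ⟨J, hJ⟩ : ∃ J, N = r + J + 1 := ⟨N - r - 1, by omega⟩
    have hterm : ∀ j ∈ Finset.range (J + 1), (b ^ ((r + 1) * (r + 1 + j)))⁻¹ * (-1) ^ (r + 1 + j)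
        * qBinom b (r + 1 + j - 1) r * (b ^ ((r + 1 + j + 1).choose 2)
          * (b ^ (r + M + 1 - (r + 1 + j)) * qBinom b (r + M) (r + 1 + j - 1)))
        = (b ^ ((r + 1).choose 2))⁻¹ * (-1) ^ (r + 1) * b ^ M * qBinom b (r + M) r
          * ((-1) ^ j * b ^ (j.choose 2) * qBinom b M j) := by
      intro j _
      have h1 := qBinom_mul_qBinom hb0 hb1 (r + M) r j
      rw [Nat.add_sub_cancel_left] at h1
      rw [show r + 1 + j - 1 = r + j by omega, show r + M + 1 - (r + 1 + j) = M - j by omega]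
      rcases lt_or_ge M j with hMj | hMj
      · rw [qBinom_of_lt b hMj, qBinom_of_lt b (show r + M < r + j by omega)]
        ring
      obtain ⟨e, rfl⟩ := Nat.exists_eq_add_of_le hMj
      rw [Nat.add_sub_cancel_left]
      have h2 : (r + 1 + j + 1).choose 2 + e + (r + 1).choose 2
          = (r + 1) * (r + 1 + j) + (j + e) + j.choose 2 := by
        have e1 := Nat.triangle_succ (r + 1 + j)
        have e2 := Nat.triangle_succ r
        rw [Nat.choose_two_right, Nat.choose_two_right, Nat.choose_two_right]
        have a1 := Nat.even_mul_succ_self (r + 1 + j)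
        have a2 := Nat.even_mul_succ_self r
        have a3 := Nat.even_mul_pred_self j
        obtain ⟨x1, hx1⟩ := a1
        obtain ⟨x2, hx2⟩ := a2
        obtain ⟨x3, hx3⟩ := a3
        rw [Nat.add_sub_cancel, Nat.add_sub_cancel, hx3, mul_comm (r + 1 + j + 1), hx1,
          mul_comm (r + 1) r, hx2]
        have hj2 : j * j = j * (j - 1) + j := by cases j <;> simp [Nat.mul_succ]
        have : x1 + x2 = (r + 1) * (r + 1 + j) + j + x3 := by nlinarith
        omega
      have h3 : b ^ ((r + 1 + j + 1).choose 2) * b ^ e * b ^ ((r + 1).choose 2)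
          = b ^ ((r + 1) * (r + 1 + j)) * b ^ (j + e) * b ^ (j.choose 2) := by
        rw [← pow_add, ← pow_add, ← pow_add, ← pow_add, h2]
      have n1 : b ^ ((r + 1) * (r + 1 + j)) ≠ 0 := (pow_pos hb0 _).ne'
      have n2 : b ^ ((r + 1).choose 2) ≠ 0 := (pow_pos hb0 _).ne'
      generalize b ^ ((r + 1 + j + 1).choose 2) = A at *
      generalize b ^ ((r + 1) * (r + 1 + j)) = B at *
      generalize b ^ ((r + 1).choose 2) = D at *
      rw [pow_add (-1 : ℝ) (r + 1) j]
      generalize b ^ (j.choose 2) = G at *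
      field_simp
      linear_combination (qBinom b (r + (j + e)) (r + j) * qBinom b (r + j) r) * h3
        + (B * b ^ (j + e) * G) * h1
    have hIcc : ∀ F : ℕ → ℝ, ∑ k ∈ Finset.Icc (r + 1) N, F k
        = ∑ j ∈ Finset.range (J + 1), F (r + 1 + j) := by
      intro F
      rw [← Finset.Ico_add_one_right_eq_Icc, Finset.sum_Ico_eq_sum_range]
      congr 2
      omega
    rw [hIcc, Finset.sum_congr rfl hterm, ← Finset.mul_sum]
    cases M with
    | zero =>
      have hs : ∑ j ∈ Finset.range (J + 1), (-1) ^ j * b ^ (j.choose 2) * qBinom b 0 j = 1 := by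
        rw [Finset.sum_range_succ', Finset.sum_eq_zero]
        · simp [qBinom_zero_right]
        · intro j _
          rw [qBinom_of_lt b (Nat.succ_pos j), mul_zero]
      rw [hs, if_neg (by omega), if_pos (by omega), add_zero, qBinom_self hb0 hb1]
      have n2 : b ^ ((r + 1).choose 2) ≠ 0 := (pow_pos hb0 _).ne'
      have h1 : ((-1 : ℝ) ^ r) * (-1) ^ r = 1 := by rw [← mul_pow]; simp
      field_simp
      linear_combination -h1
    | succ M =>
      rw [sum_neg_one_pow_mul_qBinom hb0 hb1, qBinom_of_lt b (show M < J by omega),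
        if_pos (by omega), if_pos (by omega)]
      ring

/-- The sum of `b ^ κ(S)` over the sets of `k` particles among the first `p`. -/
lemma sum_pow_kappa {N p : ℕ} (hp : p ≤ N) (k : ℕ) :
    ∑ S ∈ ((Finset.univ : Finset (Fin N)).filter fun i => i.1 < p).powersetCard k, b ^ kappa S
      = b ^ ((k + 1).choose 2) * qBinom b p k := by
  induction p generalizing k with
  | zero =>
    have h : ((Finset.univ : Finset (Fin N)).filter fun i => i.1 < 0) = ∅ := by simp
    rw [h]
    cases k with
    | zero => simp [kappa, qBinom_zero_right]
    | succ k =>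
      rw [Finset.powersetCard_eq_empty.2 (by simp), qBinom_of_lt b (Nat.succ_pos k)]
      simp
  | succ p ih =>
    cases k with
    | zero => simp [kappa, qBinom_zero_right]
    | succ k =>
      set i₀ : Fin N := ⟨p, by omega⟩ with hi₀
      have h : ((Finset.univ : Finset (Fin N)).filter fun i => i.1 < p + 1)
          = insert i₀ ((Finset.univ : Finset (Fin N)).filter fun i => i.1 < p) := by
        ext i
        simp only [Finset.mem_filter, Finset.mem_univ, true_and, Finset.mem_insert, hi₀,
          Fin.ext_iff]
        omega
      have hni : i₀ ∉ (Finset.univ : Finset (Fin N)).filter fun i => i.1 < p := by simp [hi₀]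
      have hmem : ∀ S ∈ ((Finset.univ : Finset (Fin N)).filter fun i => i.1 < p).powersetCard k,
          i₀ ∉ S := fun S hS h' => hni ((Finset.mem_powersetCard.1 hS).1 h')
      rw [h, Finset.powersetCard_succ_insert hni, Finset.sum_union, Finset.sum_image,
        ih (by omega), Finset.sum_congr rfl fun S hS => by
          rw [kappa, Finset.sum_insert (hmem S hS), pow_add], ← Finset.mul_sum]
      · have ih' := ih (by omega) k
        simp only [kappa] at ih'
        rw [ih', Nat.choose_succ_succ' (k + 1) 1, Nat.choose_one_right]
        rcases lt_or_ge p k with hpk | hpk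
        · simp [qBinom_of_lt b hpk, qBinom_of_lt b (show p + 1 < k + 1 by omega),
            qBinom_of_lt b (show p < k + 1 by omega)]
        · rw [qBinom_pascal' hb0 hb1 hpk]
          obtain ⟨d, rfl⟩ := Nat.exists_eq_add_of_le hpk
          rw [Nat.add_sub_cancel_left]
          simp only [hi₀]
          ring
      · intro S hS S' hS' hSS'
        rw [← Finset.erase_insert (hmem S hS), ← Finset.erase_insert (hmem S' hS'), hSS']
      · rw [Finset.disjoint_left]
        intro S hS hS'
        obtain ⟨S', -, rfl⟩ := Finset.mem_image.1 hS'
        exact hni ((Finset.mem_powersetCard.1 hS).1 (Finset.mem_insert_self _ _))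

end QBinom

/-! ### The integrals of the one-point formula in the inverse variables -/

/-- The eigenvalue of the generator of a single particle on `y ↦ w ^ y`. -/
def jumpSymbol (b : ℝ) (w : ℂ) : ℂ := (w - 1) / (1 - b * w)

/-- The symmetric part at time `0` of the integrand over the variables of `S`. -/
def baseWeight {ι : Type*} (x : ℕ) (S : Finset ι) (w : ι → ℂ) : ℂ :=
  ((∏ i ∈ S, w i) - 1) * (∏ i ∈ S, 1 / (1 - w i)) * ∏ i ∈ S, (w i)⁻¹ ^ x

/-- The symmetric part of the integrand to which the generator has been applied `n` times. -/
def weight {ι : Type*} (b : ℝ) (x n : ℕ) (S : Finset ι) (w : ι → ℂ) : ℂ :=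
  baseWeight x S w * (∑ i ∈ S, jumpSymbol b (w i)) ^ n

/-- The symmetric part of the integrand at time `t`. -/
def expWeight {ι : Type*} (b t : ℝ) (x : ℕ) (S : Finset ι) (w : ι → ℂ) : ℂ :=
  baseWeight x S w * Complex.exp (t * ∑ i ∈ S, jumpSymbol b (w i))

section Weight

variable {ι : Type*} {b R : ℝ} (hb0 : 0 < b) (hb1 : b < 1) (hR : 1 < R)

include hb0 hb1 hR

omit hb0 hb1 in
lemma one_sub_ne_zero_of_mem_torus {w : ι → ℂ} (hw : w ∈ torus ι R) (i : ι) : 1 - w i ≠ 0 := by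
  intro h
  have h1 := hw i
  rw [← sub_eq_zero.1 h, norm_one] at h1
  exact absurd h1 (inv_lt_one_of_one_lt₀ hR).ne'

omit hb1 in
lemma one_sub_le_norm {w : ι → ℂ} (hw : w ∈ torus ι R) (i : ι) : 1 - b ≤ ‖1 - b * w i‖ := by
  have h1 : ‖(b : ℂ) * w i‖ ≤ b := by
    rw [norm_mul, hw i, Complex.norm_real, Real.norm_of_nonneg hb0.le]
    exact mul_le_of_le_one_right hb0.le (inv_lt_one_of_one_lt₀ hR).le
  have h2 := norm_sub_norm_le (1 : ℂ) (b * w i)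
  rw [norm_one] at h2
  linarith

lemma continuousOn_jumpSymbol (S : Finset ι) :
    ContinuousOn (fun w : ι → ℂ => ∑ i ∈ S, jumpSymbol b (w i)) (torus ι R) := by
  refine continuousOn_finsetSum S fun i _ => ?_
  refine ((continuous_apply i).continuousOn.sub continuousOn_const).div (continuousOn_const.sub
    (continuousOn_const.mul (continuous_apply i).continuousOn)) fun w hw h => ?_
  have := one_sub_le_norm hb0 hR hw i
  rw [h, norm_zero] at this
  linarith

lemma norm_sum_jumpSymbol_le [Fintype ι] (S : Finset ι) {w : ι → ℂ} (hw : w ∈ torus ι R) :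
    ‖∑ i ∈ S, jumpSymbol b (w i)‖ ≤ Fintype.card ι * (2 / (1 - b)) := by
  have hb : 0 < 1 - b := by linarith
  have h1 : ∀ i ∈ S, ‖jumpSymbol b (w i)‖ ≤ 2 / (1 - b) := by
    intro i _
    rw [jumpSymbol, norm_div]
    have h2 : ‖w i - 1‖ ≤ 2 := by
      refine (norm_sub_le _ _).trans ?_
      rw [hw i, norm_one]
      have := (inv_lt_one_of_one_lt₀ hR).le
      linarith
    exact div_le_div₀ zero_le_two h2 hb (one_sub_le_norm hb0 hR hw i)
  refine (norm_sum_le_of_le S h1).trans ?_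
  rw [Finset.sum_const, nsmul_eq_mul]
  gcongr
  exact Finset.card_le_univ S

omit hb0 hb1 in
lemma continuousOn_baseWeight (x : ℕ) (S : Finset ι) :
    ContinuousOn (baseWeight x S) (torus ι R) := by
  have hR0 : 0 < R := by linarith
  refine ((((continuous_finsetProd S fun i _ => continuous_apply i).continuousOn.sub
    continuousOn_const).mul (continuousOn_finsetProd S fun i _ => ?_))).mul
    (continuousOn_finsetProd S fun i _ => ?_)
  · exact continuousOn_const.div (continuousOn_const.sub (continuous_apply i).continuousOn)
      fun w hw => one_sub_ne_zero_of_mem_torus hR hw i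
  · exact ((continuous_apply i).continuousOn.inv₀ fun w hw =>
      ne_zero_of_mem_torus hR0 hw i).pow x

lemma continuousOn_weight (x n : ℕ) (S : Finset ι) :
    ContinuousOn (weight b x n S) (torus ι R) :=
  (continuousOn_baseWeight hR x S).mul ((continuousOn_jumpSymbol hb0 hb1 hR S).pow n)

lemma continuousOn_expWeight (t : ℝ) (x : ℕ) (S : Finset ι) :
    ContinuousOn (expWeight b t x S) (torus ι R) :=
  (continuousOn_baseWeight hR x S).mul
    (continuousOn_const.mul (continuousOn_jumpSymbol hb0 hb1 hR S)).cexp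

end Weight

lemma isSymmWeight_weight {N : ℕ} {b R : ℝ} (hb0 : 0 < b) (hb1 : b < 1) (hR : 1 < R) (x n : ℕ) :
    IsSymmWeight (N := N) R (weight b x n) where
  continuousOn := continuousOn_weight hb0 hb1 hR x n
  map_equiv e S w := by
    simp [weight, baseWeight, Finset.prod_map, Finset.sum_map]

lemma interaction_map {ι κ : Type*} [LinearOrder ι] [LinearOrder κ] (b : ℝ) (e : κ ↪o ι)
    (S : Finset κ) (w : ι → ℂ) :
    interaction b (S.map e.toEmbedding) w = interaction b S fun i => w (e i) := by
  simp [interaction, Finset.prod_map]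

lemma prod_Ioi_const {k : ℕ} (c : ℂ) :
    ∏ i : Fin k, ∏ _j ∈ Finset.Ioi i, c = c ^ (k * (k - 1) / 2) := by
  simp only [Finset.prod_const, Fin.card_Ioi]
  rw [Finset.prod_pow_eq_pow_sum, Fin.sum_univ_eq_sum_range (fun i => k - 1 - i) k,
    Finset.sum_range_reflect (fun i => i) k, Finset.sum_range_id]

section Change

variable {b R : ℝ} (hb0 : 0 < b) (hb1 : b < 1) (hR0 : 0 < R) (hR : 1 + b + b / R < R)

include hb0 hb1 hR0 hR

omit hb1 in
/-- The integrand after the substitution `z = w⁻¹`, with the Jacobian. -/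
lemma prod_inv_mul_integrand (t : ℝ) (x : ℕ) {k : ℕ} (y : Fin k → ℕ) {w : Fin k → ℂ}
    (hw : w ∈ torus (Fin k) R) :
    (∏ i, (w i)⁻¹) * integrand b t x y (fun i => (w i)⁻¹)
      = (b : ℂ) ^ (k * (k - 1) / 2) * (-1) ^ k * (interaction b Finset.univ w
        * expWeight b t x Finset.univ w * ∏ i, w i ^ y i) := by
  have h0 := ne_zero_of_mem_torus hR0 hw
  have h1 := one_sub_ne_zero_of_mem_torus (one_lt_radius hb0 hR0 hR) hw
  have hbc : (b : ℂ) ≠ 0 := by exact_mod_cast hb0.ne'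
  have e1 : (∏ i : Fin k, ∏ j ∈ Finset.Ioi i, ((w j)⁻¹ - (w i)⁻¹) /
      (1 - (1 + (b : ℂ)⁻¹) * (w i)⁻¹ + (b : ℂ)⁻¹ * (w i)⁻¹ * (w j)⁻¹))
      = (b : ℂ) ^ (k * (k - 1) / 2) * interaction b Finset.univ w := by
    have h2 : ∀ i j : Fin k, ((w j)⁻¹ - (w i)⁻¹) /
        (1 - (1 + (b : ℂ)⁻¹) * (w i)⁻¹ + (b : ℂ)⁻¹ * (w i)⁻¹ * (w j)⁻¹)
        = b * ratio b (w i) (w j) := by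
      intro i j
      have hi := h0 i
      have hj := h0 j
      have hd := den_ne_zero hb0 hR0 hR (hw i).le (hw j).le
      have h3 : 1 - (1 + (b : ℂ)⁻¹) * (w i)⁻¹ + (b : ℂ)⁻¹ * (w i)⁻¹ * (w j)⁻¹
          = den b (w i) (w j) / (b * w i * w j) := by
        unfold den
        field_simp
        ring
      have h4 : (w j)⁻¹ - (w i)⁻¹ = (w i - w j) / (w i * w j) := by
        field_simp
      rw [h3, h4, ratio]
      field_simp
    simp only [h2]
    simp only [Finset.prod_mul_distrib, prod_Ioi_const, interaction]
    congr 1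
    refine Finset.prod_congr rfl fun i _ => ?_
    rw [← Finset.prod_filter]
    refine Finset.prod_congr ?_ fun _ _ => rfl
    ext j; simp
  have e2 : (1 - ∏ i, (w i)⁻¹) / ∏ i, (1 - (w i)⁻¹)
      = (-1) ^ k * (((∏ i, w i) - 1) * ∏ i, 1 / (1 - w i)) := by
    have h2 : ∏ i, (1 - (w i)⁻¹) = (-1) ^ k * (∏ i, (1 - w i)) * (∏ i, w i)⁻¹ := by
      rw [← Finset.prod_inv_distrib]
      have h3 : ((-1 : ℂ)) ^ k = ∏ _i : Fin k, (-1 : ℂ) := by simp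
      rw [h3, ← Finset.prod_mul_distrib, ← Finset.prod_mul_distrib]
      refine Finset.prod_congr rfl fun i _ => ?_
      have := h0 i
      field_simp
      ring
    have h4 : (∏ i, w i) ≠ 0 := Finset.prod_ne_zero_iff.2 fun i _ => h0 i
    have h5 : (∏ i, (1 - w i)) ≠ 0 := Finset.prod_ne_zero_iff.2 fun i _ => h1 i
    have h6 : ((-1 : ℂ)) ^ k * (-1) ^ k = 1 := by rw [← mul_pow]; simp
    have h7 : ((-1 : ℂ)) ^ k ≠ 0 := pow_ne_zero _ (by simp)
    rw [h2, Finset.prod_inv_distrib, Finset.prod_div_distrib, Finset.prod_const_one]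
    field_simp
    linear_combination (-1 + ∏ i, w i) * (-h6)
  have e3 : (∏ i, (w i)⁻¹) * ∏ i, ((w i)⁻¹ ^ ((x : ℤ) - (y i : ℤ) - 1)
        * Complex.exp (-(t : ℂ) * ((1 - ((w i)⁻¹)⁻¹) / (1 - (b : ℂ) * ((w i)⁻¹)⁻¹))))
      = (∏ i, (w i)⁻¹ ^ x) * Complex.exp (t * ∑ i, jumpSymbol b (w i)) * ∏ i, w i ^ y i := by
    rw [Finset.mul_sum, Complex.exp_sum, ← Finset.prod_mul_distrib, ← Finset.prod_mul_distrib,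
      ← Finset.prod_mul_distrib]
    refine Finset.prod_congr rfl fun i _ => ?_
    have hi := inv_ne_zero (h0 i)
    rw [inv_inv, zpow_sub_one₀ hi, zpow_sub₀ hi, zpow_natCast, zpow_natCast, inv_inv, jumpSymbol]
    have h2 : -(t : ℂ) * ((1 - w i) / (1 - b * w i)) = t * ((w i - 1) / (1 - b * w i)) := by ring
    rw [h2, inv_pow, inv_pow, div_inv_eq_mul]
    have := h0 i
    field_simp
  unfold integrand
  rw [e1, e2, expWeight, baseWeight]
  linear_combination ((b : ℂ) ^ (k * (k - 1) / 2) * interaction b Finset.univ w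
    * ((-1) ^ k * (((∏ i, w i) - 1) * ∏ i, 1 / (1 - w i)))) * e3

/-- The contour integral of the one-point formula in the inverse variables. -/
lemma contourIntegral_eq {N : ℕ} (t : ℝ) (x : ℕ) (y : State N) (S : Finset (Fin N)) :
    contourIntegral b t R x y S = (b : ℂ) ^ (S.card * (S.card - 1) / 2) * (-1) ^ S.card *
      ∫ w, interaction b S w * expWeight b t x S w * ∏ i ∈ S, w i ^ y.1 i
        ∂torusLaw (Fin N) R := by
  set e := S.orderEmbOfFin rfl with he
  have hS : S = Finset.univ.map e.toEmbedding := by rw [he, Finset.map_orderEmbOfFin_univ]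
  set G : (Fin S.card → ℂ) → ℂ := fun w => interaction b Finset.univ w
        * expWeight b t x Finset.univ w * ∏ i, w i ^ y.1 (e i) with hG
  have hGc : ContinuousOn G (torus (Fin S.card) R) :=
    ((polyHol_interaction hb0 hR0 hR _).continuousOn.fun_mul
      (continuousOn_expWeight hb0 hb1 (one_lt_radius hb0 hR0 hR) t x _)).fun_mul
      (continuous_finsetProd _ fun i _ => (continuous_apply i).pow _).continuousOn
  have hGm := (integrable_of_continuousOn hR0 hGc).aestronglyMeasurable
  have hpt : ∀ w ∈ torus (Fin S.card) R, (∏ i, (w i)⁻¹)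
      * integrand b t x (fun i => y.1 (e i)) (fun i => (w i)⁻¹)
      = (b : ℂ) ^ (S.card * (S.card - 1) / 2) * (-1) ^ S.card * G w := fun w hw =>
    prod_inv_mul_integrand hb0 hR0 hR t x (fun i => y.1 (e i)) hw
  rw [contourIntegral, torusIntegral_eq_integral_torusLaw, integral_torusLaw_congr hR0 hpt,
    integral_const_mul, ← integral_torusLaw_comp_injective R e.injective G hGm]
  · congr 2
    ext w
    conv_rhs => rw [hS]
    rw [interaction_map]
    simp [hG, expWeight, baseWeight, Finset.prod_map, Finset.sum_map]
  · exact (hGm.const_mul ((b : ℂ) ^ (S.card * (S.card - 1) / 2) * (-1) ^ S.card)).congr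
      ((ae_mem_torus hR0).mono fun w hw => (hpt w hw).symm)

end Change

/-! ### The functions obtained from the one-point formula by applying the generator -/

section Mix

variable {N : ℕ} {b R : ℝ} (hb0 : 0 < b) (hb1 : b < 1) (hR0 : 0 < R) (hR : 1 + b + b / R < R)

/-- A linear combination of the functions `setSum b R Q k`, `m ≤ k ≤ N`. -/
def mix (b R : ℝ) (m : ℕ) (c : ℕ → ℝ) (Q : Finset (Fin N) → (Fin N → ℂ) → ℂ) (y : Fin N → ℕ) : ℂ :=
  ∑ k ∈ Finset.Icc m N, (c k : ℂ) * setSum b R Q k y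

include hb0 hb1 hR0 hR

lemma exists_mix_bound (m : ℕ) (c : ℕ → ℝ) (x : ℕ) : ∃ C : ℝ, ∀ (n : ℕ) (y : Fin N → ℕ),
    ‖mix b R m c (weight b x n) y‖ ≤ C * (N * (2 / (1 - b))) ^ n := by
  have hR1 := one_lt_radius hb0 hR0 hR
  have hS : ∀ S : Finset (Fin N), ∃ C : ℝ, ∀ w ∈ torus (Fin N) R,
      ‖interaction b S w * baseWeight x S w‖ ≤ C := fun S =>
    (isCompact_torus R).exists_bound_of_continuousOn
      ((polyHol_interaction hb0 hR0 hR S).continuousOn.fun_mul (continuousOn_baseWeight hR1 x S))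
  choose D hD using hS
  refine ⟨∑ k ∈ Finset.Icc m N, |c k| *
    ∑ S ∈ (Finset.univ : Finset (Fin N)).powersetCard k, b ^ kappa S * D S, fun n y => ?_⟩
  rw [mix, Finset.sum_mul]
  refine norm_sum_le_of_le _ fun k _ => ?_
  rw [norm_mul, Complex.norm_real, Real.norm_eq_abs, mul_assoc]
  refine mul_le_mul_of_nonneg_left ?_ (abs_nonneg _)
  rw [setSum, Finset.sum_mul]
  refine norm_sum_le_of_le _ fun S _ => ?_
  rw [norm_mul, norm_pow, Complex.norm_real, Real.norm_of_nonneg hb0.le, mul_assoc]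
  refine mul_le_mul_of_nonneg_left ?_ (by positivity)
  have h := norm_integral_le_of_norm_le_const (μ := torusLaw (Fin N) R)
    (f := fun w => interaction b S w * weight b x n S w * ∏ i ∈ S, w i ^ y i)
    (C := D S * (N * (2 / (1 - b))) ^ n) ((ae_mem_torus hR0).mono fun w hw => ?_)
  · simpa using h
  have h1 : ‖∏ i ∈ S, w i ^ y i‖ ≤ 1 := by
    rw [norm_prod]
    refine Finset.prod_le_one (fun _ _ => norm_nonneg _) fun i _ => ?_
    rw [norm_pow, hw i]
    exact pow_le_one₀ (by positivity) (inv_lt_one_of_one_lt₀ hR1).le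
  have h2 := norm_sum_jumpSymbol_le hb0 hb1 hR1 S hw
  rw [Fintype.card_fin] at h2
  rw [weight, ← mul_assoc, norm_mul, norm_mul, norm_pow]
  have h3 := (norm_nonneg _).trans (hD S w hw)
  calc _ ≤ ‖interaction b S w * baseWeight x S w‖ * ‖∑ i ∈ S, jumpSymbol b (w i)‖ ^ n * 1 := by
        gcongr
    _ ≤ _ := by
        rw [mul_one]
        gcongr
        exact hD S w hw

omit hb0 hb1 hR0 hR in
/-- The value of the geometric sum over the shifts `c, c + 1, ...` of particle `l`. -/
def mixShift (b R : ℝ) (m : ℕ) (c : ℕ → ℝ) (Q : Finset (Fin N) → (Fin N → ℂ) → ℂ) (y : Fin N → ℕ)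
    (l : Fin N) (a : ℕ) : ℂ :=
  ∑ k ∈ Finset.Icc m N, (c k : ℂ) *
    ∑ S ∈ (Finset.univ : Finset (Fin N)).powersetCard k, (b : ℂ) ^ kappa S *
      ∫ w, interaction b S w * Q S w * (∏ i ∈ S, w i ^ y i) * shiftFactor b S l a w
        ∂torusLaw (Fin N) R

lemma hasSum_mix {Q : Finset (Fin N) → (Fin N → ℂ) → ℂ} (hQ : IsSymmWeight R Q) (m : ℕ)
    (c : ℕ → ℝ) (y : Fin N → ℕ) (l : Fin N) (a : ℕ) :
    HasSum (fun j : ℕ => (b : ℂ) ^ j * mix b R m c Q (Function.update y l (y l + a + j)))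
      (mixShift b R m c Q y l a) := by
  have h := hasSum_sum (s := Finset.Icc m N) fun k _ =>
    (hasSum_setSum hb0 hb1 hR0 hR hQ l k y a).mul_left (c k : ℂ)
  have e : (fun j : ℕ => (b : ℂ) ^ j * mix b R m c Q (Function.update y l (y l + a + j)))
      = fun j : ℕ => ∑ k ∈ Finset.Icc m N, (c k : ℂ) *
        ((b : ℂ) ^ j * setSum b R Q k (Function.update y l (y l + a + j))) := by
    ext j
    rw [mix, Finset.mul_sum]
    exact Finset.sum_congr rfl fun k _ => by ring
  rw [e]
  exact h

lemma hasSum_map_mix {Q : Finset (Fin N) → (Fin N → ℂ) → ℂ} (hQ : IsSymmWeight R Q) (m : ℕ)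
    (c : ℕ → ℝ) (φ : ℂ →L[ℝ] ℝ) (y : Fin N → ℕ) (l : Fin N) (a : ℕ) :
    HasSum (fun j : ℕ => b ^ j * φ (mix b R m c Q (Function.update y l (y l + a + j))))
      (φ (mixShift b R m c Q y l a)) := by
  have h := (hasSum_mix hb0 hb1 hR0 hR hQ m c y l a).mapL φ
  have e : (fun j : ℕ => b ^ j * φ (mix b R m c Q (Function.update y l (y l + a + j))))
      = fun j : ℕ => φ ((b : ℂ) ^ j * mix b R m c Q (Function.update y l (y l + a + j))) := by
    ext j
    rw [← Complex.ofReal_pow, ← Complex.real_smul, map_smul, smul_eq_mul]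
  rw [e]
  exact h

lemma boundaryFrom_mix {Q : Finset (Fin N) → (Fin N → ℂ) → ℂ} (hQ : IsSymmWeight R Q) (m : ℕ)
    (c : ℕ → ℝ) (φ : ℂ →L[ℝ] ℝ) (i : Fin N) :
    BoundaryFrom b i fun y => φ (mix b R m c Q y) := by
  intro l l' hl _ y hy
  have h1 := hasSum_map_mix hb0 hb1 hR0 hR hQ m c φ y l 0
  have h2 := hasSum_map_mix hb0 hb1 hR0 hR hQ m c φ y l' 1
  have h3 : mixShift b R m c Q y l 0 = mixShift b R m c Q y l' 1 := by
    refine Finset.sum_congr rfl fun k _ => ?_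
    rw [sum_integral_boundary hb0 hb1 hR0 hR hQ hl k hy]
  simp only [add_zero] at h1
  rw [h1.tsum_eq, h2.tsum_eq, h3]

omit hR0 in
lemma sum_shiftFactor_sub (S : Finset (Fin N)) {w : Fin N → ℂ} (hw : w ∈ torus (Fin N) R)
    (hR0 : 0 < R) :
    ∑ l, ((1 - (b : ℂ)) * shiftFactor b S l 1 w - 1) = ∑ i ∈ S, jumpSymbol b (w i) := by
  have h3 : (1 : ℂ) - b ≠ 0 := by rw [sub_ne_zero]; exact_mod_cast hb1.ne'
  have h : ∀ l, (1 - (b : ℂ)) * shiftFactor b S l 1 w - 1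
      = if l ∈ S then jumpSymbol b (w l) else 0 := by
    intro l
    have h1 := one_sub_mul_ne_zero hb0 hb1 hR0 hR hw l
    unfold shiftFactor jumpSymbol
    split_ifs
    · field_simp
      ring
    · field_simp
      ring
  simp only [h, Finset.sum_ite_mem, Finset.univ_inter]

lemma sum_mixShift_sub (m : ℕ) (c : ℕ → ℝ) (x n : ℕ) (y : Fin N → ℕ) :
    ∑ l, ((1 - (b : ℂ)) * mixShift b R m c (weight b x n) y l 1 - mix b R m c (weight b x n) y)
      = mix b R m c (weight b x (n + 1)) y := by
  have hR1 := one_lt_radius hb0 hR0 hR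
  have hc : ∀ S : Finset (Fin N), ContinuousOn (fun w : Fin N → ℂ => interaction b S w *
      weight b x n S w * ∏ i ∈ S, w i ^ y i) (torus (Fin N) R) := fun S =>
    (continuousOn_interaction_mul hb0 hR0 hR (isSymmWeight_weight hb0 hb1 hR1 x n) S).fun_mul
      (continuous_finsetProd S fun i _ => (continuous_apply i).pow _).continuousOn
  have hS : ∀ S : Finset (Fin N), ∑ l, ((1 - (b : ℂ)) *
      (∫ w, interaction b S w * weight b x n S w * (∏ i ∈ S, w i ^ y i) * shiftFactor b S l 1 w
        ∂torusLaw (Fin N) R)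
      - ∫ w, interaction b S w * weight b x n S w * ∏ i ∈ S, w i ^ y i ∂torusLaw (Fin N) R)
      = ∫ w, interaction b S w * weight b x (n + 1) S w * ∏ i ∈ S, w i ^ y i
        ∂torusLaw (Fin N) R := by
    intro S
    have hcs : ∀ l, ContinuousOn (fun w : Fin N → ℂ => interaction b S w *
        weight b x n S w * (∏ i ∈ S, w i ^ y i) * shiftFactor b S l 1 w) (torus (Fin N) R) :=
      fun l => (hc S).fun_mul (continuousOn_shiftFactor hb0 hb1 hR0 hR l 1 S)
    have h1 : ∀ l, (1 - (b : ℂ)) *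
      (∫ w, interaction b S w * weight b x n S w * (∏ i ∈ S, w i ^ y i) * shiftFactor b S l 1 w
        ∂torusLaw (Fin N) R)
      - ∫ w, interaction b S w * weight b x n S w * ∏ i ∈ S, w i ^ y i ∂torusLaw (Fin N) R
      = ∫ w, ((1 - (b : ℂ)) * (interaction b S w * weight b x n S w * (∏ i ∈ S, w i ^ y i)
          * shiftFactor b S l 1 w) - interaction b S w * weight b x n S w * ∏ i ∈ S, w i ^ y i)
          ∂torusLaw (Fin N) R := by
      intro l
      rw [integral_sub, integral_const_mul]
      · exact integrable_of_continuousOn hR0 (continuousOn_const.fun_mul (hcs l))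
      · exact integrable_of_continuousOn hR0 (hc S)
    simp only [h1]
    rw [← integral_finsetSum]
    · refine integral_torusLaw_congr hR0 fun w hw => ?_
      have h2 := sum_shiftFactor_sub hb0 hb1 hR S hw hR0
      have h3 : weight b x (n + 1) S w = weight b x n S w * ∑ i ∈ S, jumpSymbol b (w i) := by
        rw [weight, weight, pow_succ, mul_assoc]
      rw [h3, ← h2, Finset.mul_sum, Finset.mul_sum, Finset.sum_mul]
      exact Finset.sum_congr rfl fun l _ => by ring
    · exact fun l _ => integrable_of_continuousOn hR0
        ((continuousOn_const.fun_mul (hcs l)).fun_sub (hc S))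
  simp only [mix, mixShift, setSum, ← hS]
  simp only [Finset.mul_sum, Finset.sum_sub_distrib, mul_sub]
  congr 1
  · rw [Finset.sum_comm]
    refine Finset.sum_congr rfl fun k _ => ?_
    rw [Finset.sum_comm]
    refine Finset.sum_congr rfl fun S _ => Finset.sum_congr rfl fun l _ => by ring
  · rw [Finset.sum_comm]
    refine Finset.sum_congr rfl fun k _ => ?_
    rw [Finset.sum_comm]

/-- The generator multiplies the integrands by the sum of the one-particle symbols. -/
lemma generator_mix (m : ℕ) (c : ℕ → ℝ) (x n : ℕ) (φ : ℂ →L[ℝ] ℝ) (hφ : ∀ z, |φ z| ≤ ‖z‖)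
    (y : State N) :
    generator b (fun y : State N => φ (mix b R m c (weight b x n) y.1)) y
      = φ (mix b R m c (weight b x (n + 1)) y.1) := by
  have hR1 := one_lt_radius hb0 hR0 hR
  have hQ := isSymmWeight_weight (N := N) hb0 hb1 hR1 x n
  obtain ⟨C, hC⟩ := exists_mix_bound (N := N) hb0 hb1 hR0 hR m c x
  rw [generator_eq_sum hb0 hb1 y (f := fun y => φ (mix b R m c (weight b x n) y))
    (fun y => (hφ _).trans (hC n y)) (boundaryFrom_mix hb0 hb1 hR0 hR hQ m c φ),
    ← sum_mixShift_sub hb0 hb1 hR0 hR, map_sum]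
  refine Finset.sum_congr rfl fun l _ => ?_
  rw [(hasSum_map_mix hb0 hb1 hR0 hR hQ m c φ y.1 l 1).tsum_eq, map_sub, ← Complex.ofReal_one,
    ← Complex.ofReal_sub, ← Complex.real_smul, map_smul, smul_eq_mul]

/-- The exponential series of the generator gives the integrals at time `t`. -/
lemma hasSum_mix_exp (m : ℕ) (c : ℕ → ℝ) (x : ℕ) (t : ℝ) (y : Fin N → ℕ) :
    HasSum (fun n : ℕ => ((t ^ n / n.factorial : ℝ) : ℂ) * mix b R m c (weight b x n) y)
      (mix b R m c (expWeight b t x) y) := by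
  have hR1 := one_lt_radius hb0 hR0 hR
  have hS : ∀ S : Finset (Fin N), HasSum (fun n : ℕ => ((t ^ n / n.factorial : ℝ) : ℂ) *
      ∫ w, interaction b S w * weight b x n S w * ∏ i ∈ S, w i ^ y i ∂torusLaw (Fin N) R)
      (∫ w, interaction b S w * expWeight b t x S w * ∏ i ∈ S, w i ^ y i
        ∂torusLaw (Fin N) R) := by
    intro S
    have hm : ContinuousOn (fun w : Fin N → ℂ => ∏ i ∈ S, w i ^ y i) (torus (Fin N) R) :=
      (continuous_finsetProd S fun i _ => (continuous_apply i).pow _).continuousOn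
    have hI := (polyHol_interaction hb0 hR0 hR S).continuousOn
    obtain ⟨D, hD⟩ := (isCompact_torus R).exists_bound_of_continuousOn
      ((hI.fun_mul (continuousOn_baseWeight hR1 x S)).fun_mul hm)
    simp_rw [← integral_const_mul]
    refine hasSum_integral_torusLaw hR0
      (β := fun n => D * ((|t| * (N * (2 / (1 - b)))) ^ n / n.factorial)) (fun n => ?_) ?_ ?_ ?_
    · exact continuousOn_const.fun_mul ((hI.fun_mul
        (continuousOn_weight hb0 hb1 hR1 x n S)).fun_mul hm)
    · exact (Real.summable_pow_div_factorial _).mul_left D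
    · intro n w hw
      have h2 := norm_sum_jumpSymbol_le hb0 hb1 hR1 S hw
      rw [Fintype.card_fin] at h2
      have h3 : ((t ^ n / n.factorial : ℝ) : ℂ) *
          (interaction b S w * weight b x n S w * ∏ i ∈ S, w i ^ y i)
          = interaction b S w * baseWeight x S w * (∏ i ∈ S, w i ^ y i)
            * (((t ^ n / n.factorial : ℝ) : ℂ) * (∑ i ∈ S, jumpSymbol b (w i)) ^ n) := by
        rw [weight]; ring
      have hD0 := (norm_nonneg _).trans (hD w hw)
      rw [h3, norm_mul, norm_mul (((t ^ n / n.factorial : ℝ) : ℂ)), norm_pow, Complex.norm_real,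
        norm_div, norm_pow,
        Real.norm_eq_abs, Real.norm_natCast, mul_pow, mul_div_right_comm]
      gcongr
      exact hD w hw
    · intro w _
      have h := (NormedSpace.expSeries_div_hasSum_exp (t * ∑ i ∈ S, jumpSymbol b (w i) : ℂ)).mul_left
        (interaction b S w * baseWeight x S w * ∏ i ∈ S, w i ^ y i)
      rw [← Complex.exp_eq_exp_ℂ] at h
      have e1 : interaction b S w * expWeight b t x S w * ∏ i ∈ S, w i ^ y i
          = interaction b S w * baseWeight x S w * (∏ i ∈ S, w i ^ y i)
            * Complex.exp (t * ∑ i ∈ S, jumpSymbol b (w i)) := by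
        rw [expWeight]; ring
      have e2 : (fun n : ℕ => ((t ^ n / n.factorial : ℝ) : ℂ) *
          (interaction b S w * weight b x n S w * ∏ i ∈ S, w i ^ y i))
          = fun n : ℕ => interaction b S w * baseWeight x S w * (∏ i ∈ S, w i ^ y i)
            * ((t * ∑ i ∈ S, jumpSymbol b (w i)) ^ n / n.factorial) := by
        ext n
        rw [weight, mul_pow]
        push_cast
        ring
      rw [e1, e2]
      exact h
  have h := hasSum_sum (s := Finset.Icc m N) fun k _ => (hasSum_sum
    (s := (Finset.univ : Finset (Fin N)).powersetCard k) fun S _ =>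
      (hS S).mul_left ((b : ℂ) ^ kappa S)).mul_left (c k : ℂ)
  have e : (fun n : ℕ => ((t ^ n / n.factorial : ℝ) : ℂ) * mix b R m c (weight b x n) y)
      = fun n : ℕ => ∑ k ∈ Finset.Icc m N, (c k : ℂ) *
        ∑ S ∈ (Finset.univ : Finset (Fin N)).powersetCard k, (b : ℂ) ^ kappa S *
          (((t ^ n / n.factorial : ℝ) : ℂ) * ∫ w, interaction b S w * weight b x n S w *
            ∏ i ∈ S, w i ^ y i ∂torusLaw (Fin N) R) := by
    ext n
    simp only [mix, setSum, Finset.mul_sum]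
    refine Finset.sum_congr rfl fun k _ => Finset.sum_congr rfl fun S _ => by ring
  rw [e]
  exact h

end Mix

/-! ### The initial condition and the one-point formula -/

section Initial

variable {N : ℕ} {b R : ℝ} (hb0 : 0 < b) (hb1 : b < 1) (hR0 : 0 < R) (hR : 1 + b + b / R < R)

lemma exists_threshold {P : Fin N → Prop} (hP : ∀ i j, i ≤ j → P j → P i) :
    ∃ p ≤ N, ∀ i, P i ↔ i.1 < p := by
  classical
  have hex : ∃ p, ∀ h : p < N, ¬P ⟨p, h⟩ := ⟨N, fun h => absurd h (lt_irrefl _)⟩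
  refine ⟨Nat.find hex, Nat.find_min' hex fun h => absurd h (lt_irrefl _), fun i => ⟨fun hi => ?_,
    fun hi => ?_⟩⟩
  · by_contra hle
    have hle : Nat.find hex ≤ i.1 := not_lt.1 hle
    exact Nat.find_spec hex (hle.trans_lt i.2) (hP _ _ hle hi)
  · have h := Nat.find_min hex hi
    push Not at h
    exact h.2

include hb0 hR0 hR

lemma integral_interaction_monom (S : Finset (Fin N)) (y : State N) (a : ℤ) :
    ∫ w, interaction b S w * (∏ i ∈ S, 1 / (1 - w i)) * monom S (fun i => a - y.1 i) w
      ∂torusLaw (Fin N) R = if ∀ i ∈ S, (y.1 i : ℤ) ≤ a then 1 else 0 := by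
  split_ifs with h
  · refine integral_interaction_of_strictAntiOn hb0 hR0 hR S ?_ fun i hi => ?_
    · intro i _ j _ hij
      have := y.2 hij
      simp only
      omega
    · have := h i hi
      omega
  · push Not at h
    obtain ⟨i, hi, hlt⟩ := h
    exact integral_interaction_of_neg hb0 hR0 hR S hi (by omega)

lemma integral_interaction_baseWeight (S : Finset (Fin N)) (y : State N) (x : ℕ) :
    ∫ w, interaction b S w * weight b x 0 S w * ∏ i ∈ S, w i ^ y.1 i ∂torusLaw (Fin N) R
      = (if ∀ i ∈ S, (y.1 i : ℤ) ≤ x - 1 then 1 else 0)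
        - if ∀ i ∈ S, (y.1 i : ℤ) ≤ x then 1 else 0 := by
  have hR1 := one_lt_radius hb0 hR0 hR
  have hc : ∀ n : Fin N → ℤ, Integrable (fun w : Fin N → ℂ => interaction b S w *
      (∏ i ∈ S, 1 / (1 - w i)) * monom S n w) (torusLaw (Fin N) R) := fun n =>
    integrable_of_continuousOn hR0 (((polyHol_interaction hb0 hR0 hR S).mul
      (PolyHol.prod S fun i _ => polyHol_geometric hb0 hR0 hR i)).continuousOn.fun_mul
      (continuousOn_monom hR0 S n))
  rw [← integral_interaction_monom hb0 hR0 hR S y (x - 1),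
    ← integral_interaction_monom hb0 hR0 hR S y x, ← integral_sub (hc _) (hc _)]
  refine integral_torusLaw_congr hR0 fun w hw => ?_
  have h0 := ne_zero_of_mem_torus hR0 hw
  have h1 : (∏ i ∈ S, (w i)⁻¹ ^ x) * ∏ i ∈ S, w i ^ y.1 i = monom S (fun i => x - y.1 i) w := by
    rw [monom, ← Finset.prod_mul_distrib]
    refine Finset.prod_congr rfl fun i _ => ?_
    rw [neg_sub, zpow_sub₀ (h0 i), zpow_natCast, zpow_natCast, inv_pow]
    field_simp
  have h2 : (∏ i ∈ S, w i) * monom S (fun i => x - y.1 i) w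
      = monom S (fun i => x - 1 - y.1 i) w := by
    rw [monom, monom, ← Finset.prod_mul_distrib]
    refine Finset.prod_congr rfl fun i _ => ?_
    rw [← zpow_one_add₀ (h0 i)]
    congr 1
    ring
  rw [weight, pow_zero, mul_one, baseWeight, ← h2, ← h1]
  ring

omit hR0 hR in
include hb1 in
/-- For ordered positions the set of particles at positions `≤ a` is an initial segment, so that the
alternating sum over its subsets tells whether it contains particle `m`. -/
lemma sum_threshold {m : ℕ} {i₀ : Fin N} (hi₀ : i₀.1 + 1 = m) (y : State N) (a : ℤ) :
    ∑ k ∈ Finset.Icc m N, ((-1) ^ (m - 1) * b ^ (m.choose 2) * ((b ^ (m * k))⁻¹ * (-1) ^ k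
        * qBinom b (k - 1) (m - 1))) * ∑ S ∈ (Finset.univ : Finset (Fin N)).powersetCard k,
          b ^ kappa S * (if ∀ i ∈ S, (y.1 i : ℤ) ≤ a then 1 else 0)
      = if (y.1 i₀ : ℤ) ≤ a then -1 else 0 := by
  obtain ⟨p, hp, hpi⟩ := exists_threshold (N := N) (P := fun i => (y.1 i : ℤ) ≤ a)
    fun i j hij hj => (Int.ofNat_le.2 (y.2.monotone hij)).trans hj
  have h1 : ((y.1 i₀ : ℤ) ≤ a) ↔ m ≤ p := by
    rw [hpi]
    omega
  have h2 : ∀ k, ∑ S ∈ (Finset.univ : Finset (Fin N)).powersetCard k,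
      b ^ kappa S * (if ∀ i ∈ S, (y.1 i : ℤ) ≤ a then 1 else 0)
      = b ^ ((k + 1).choose 2) * qBinom b p k := by
    intro k
    rw [← sum_pow_kappa hb0 hb1 hp]
    simp only [hpi, mul_ite, mul_one, mul_zero]
    rw [← Finset.sum_filter]
    refine Finset.sum_congr ?_ fun _ _ => rfl
    ext S
    simp only [Finset.mem_filter, Finset.mem_powersetCard, true_and,
      Finset.subset_iff, Finset.mem_univ]
    tauto
  simp only [h1, h2]
  rw [← sum_qBinom_mul_qBinom hb0 hb1 (by omega : 1 ≤ m) hp, Finset.mul_sum]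
  exact Finset.sum_congr rfl fun k _ => by ring

/-- The coefficient of the sets of `k` particles. -/
def coeff (b : ℝ) (m k : ℕ) : ℝ :=
  (-1) ^ (m - 1) * b ^ (m.choose 2) * ((b ^ (m * k))⁻¹ * (-1) ^ k * qBinom b (k - 1) (m - 1))

include hb1

/-- At time `0` the formula is the indicator of `y_m = x`. -/
lemma mix_initial {m : ℕ} {i₀ : Fin N} (hi₀ : i₀.1 + 1 = m) (x : ℕ) (y : State N) :
    mix b R m (coeff b m) (weight b x 0) y.1
      = if y.1 i₀ = x then 1 else 0 := by
  have h1 := sum_threshold hb0 hb1 hi₀ y (x - 1)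
  have h2 := sum_threshold hb0 hb1 hi₀ y x
  have h3 : mix b R m (coeff b m) (weight b x 0) y.1
      = (((if (y.1 i₀ : ℤ) ≤ x - 1 then -1 else 0)
        - (if (y.1 i₀ : ℤ) ≤ x then -1 else 0) : ℝ) : ℂ) := by
    rw [← h1, ← h2, ← Finset.sum_sub_distrib, mix, Complex.ofReal_sum]
    refine Finset.sum_congr rfl fun k _ => ?_
    rw [← mul_sub, ← Finset.sum_sub_distrib, Complex.ofReal_mul, Complex.ofReal_sum, setSum, coeff]
    congr 1
    refine Finset.sum_congr rfl fun S _ => ?_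
    rw [integral_interaction_baseWeight hb0 hR0 hR]
    push_cast
    split_ifs <;> simp
  rw [h3]
  split_ifs <;> first | omega | simp

/-- The terms of the one-point formula. -/
lemma mix_expWeight_eq {m : ℕ} (t : ℝ) (x : ℕ) (y : State N) :
    (-1) ^ (m - 1) * (b : ℂ) ^ (m * (m - 1) / 2) *
      ∑ k ∈ Finset.Icc m N, ∑ S ∈ (Finset.univ : Finset (Fin N)).powersetCard k,
        (b : ℂ) ^ ((kappa S : ℤ) - (m : ℤ) * (k : ℤ) - ((k * (k - 1) / 2 : ℕ) : ℤ))
          * (qBinom b (k - 1) (m - 1) : ℂ) * contourIntegral b t R x y S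
      = mix b R m (coeff b m) (expWeight b t x) y.1 := by
  have hbc : (b : ℂ) ≠ 0 := by exact_mod_cast hb0.ne'
  rw [mix, Finset.mul_sum]
  refine Finset.sum_congr rfl fun k _ => ?_
  rw [setSum, Finset.mul_sum, Finset.mul_sum]
  refine Finset.sum_congr rfl fun S hS => ?_
  rw [contourIntegral_eq hb0 hb1 hR0 hR, (Finset.mem_powersetCard.1 hS).2, coeff,
    Nat.choose_two_right, zpow_sub₀ hbc, zpow_sub₀ hbc, zpow_natCast, zpow_natCast,
    ← Nat.cast_mul, zpow_natCast]
  push_cast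
  have h1 : (b : ℂ) ^ (m * k) ≠ 0 := pow_ne_zero _ hbc
  have h2 : (b : ℂ) ^ (k * (k - 1) / 2) ≠ 0 := pow_ne_zero _ hbc
  field_simp

end Initial

end HLPushTASEP

end

/-- One-point distribution of `N`-particle HL-PushTASEP. The condition on `R` says that the circle
of radius `R` about `0` encloses all singularities of the integrands: it encloses `0`, `b`, `1`, and,
whenever one of `z_i`, `z_j` is on the circle, it encloses the value of the other one at which
`1 - (1 + b⁻¹) z_i + b⁻¹ z_i z_j` vanishes. -/
theorem theorem3p3 {Ω : Type*} {mΩ : MeasurableSpace Ω} (μ : Measure Ω) [IsProbabilityMeasure μ]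
    (ℱ : Filtration ℝ≥0 mΩ) (N : ℕ) (b : ℝ) (hb0 : 0 < b) (hb1 : b < 1)
    (y : HLPushTASEP.State N) (X : ℝ≥0 → Ω → HLPushTASEP.State N)
    (hX : HLPushTASEP.IsProcess b y μ ℱ X)
    (t : ℝ≥0) (ht : 0 < t) (m : ℕ) (hm : 1 ≤ m) (hmN : m ≤ N) (x : ℕ)
    (R : ℝ) (hR0 : 0 < R) (hR : 1 + b + b / R < R) :
    ((μ.real {ω | (X t ω).1 ⟨m - 1, by omega⟩ = x} : ℝ) : ℂ) =
      (-1) ^ (m - 1) * (b : ℂ) ^ (m * (m - 1) / 2) *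
        ∑ k ∈ Finset.Icc m N, ∑ S ∈ (Finset.univ : Finset (Fin N)).powersetCard k,
          (b : ℂ) ^ ((HLPushTASEP.kappa S : ℤ) - (m : ℤ) * (k : ℤ) - ((k * (k - 1) / 2 : ℕ) : ℤ))
            * (HLPushTASEP.qBinom b (k - 1) (m - 1) : ℂ)
            * HLPushTASEP.contourIntegral b t R x y S := by
  open HLPushTASEP in
  rw [mix_expWeight_eq hb0 hb1 hR0 hR]
  set c := coeff b m with hc
  obtain ⟨C, hC⟩ := exists_mix_bound (N := N) hb0 hb1 hR0 hR m c x
  -- Both sides have the same image under the real functionals `re` and `im`.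
  have key : ∀ φ : ℂ →L[ℝ] ℝ, (∀ z, |φ z| ≤ ‖z‖) →
      ∫ ω, φ (mix b R m c (weight b x 0) (X t ω).1) ∂μ
        = φ (mix b R m c (expWeight b t x) y.1) := by
    intro φ hφ
    have h1 := tendsto_sum_expectation hX
      (u := fun n (y : State N) => φ (mix b R m c (weight b x n) y.1))
      (fun n y => (hφ _).trans (hC n y.1))
      (fun n y => generator_mix hb0 hb1 hR0 hR m c x n φ hφ y) t
    have h2 := ((hasSum_mix_exp hb0 hb1 hR0 hR m c x t y.1).mapL φ).tendsto_sum_nat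
    refine tendsto_nhds_unique h1 (h2.congr fun p => Finset.sum_congr rfl fun n _ => ?_)
    rw [← Complex.real_smul, map_smul, smul_eq_mul]
  have hre := key Complex.reCLM Complex.abs_re_le_norm
  have him := key Complex.imCLM Complex.abs_im_le_norm
  have hset : MeasurableSet {ω | (X t ω).1 ⟨m - 1, by omega⟩ = x} := by
    have h1 : Measurable (X t) := hX.measurable.comp measurable_prodMk_left
    exact h1 (MeasurableSet.of_discrete (s := {y : State N | y.1 ⟨m - 1, by omega⟩ = x}))
  have hind : ∀ ω, Complex.reCLM (mix b R m c (weight b x 0) (X t ω).1)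
      = Set.indicator {ω | (X t ω).1 ⟨m - 1, by omega⟩ = x} 1 ω := by
    intro ω
    rw [hc, mix_initial hb0 hb1 hR0 hR (i₀ := ⟨m - 1, by omega⟩) (Nat.sub_add_cancel hm),
      Set.indicator_apply]
    simp only [Set.mem_ofPred_eq]
    split_ifs <;> simp
  have hind' : ∀ ω, Complex.imCLM (mix b R m c (weight b x 0) (X t ω).1) = 0 := by
    intro ω
    rw [hc, mix_initial hb0 hb1 hR0 hR (i₀ := ⟨m - 1, by omega⟩) (Nat.sub_add_cancel hm)]
    split_ifs <;> simp
  simp only [hind, integral_indicator_one hset] at hre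
  simp only [hind', integral_zero] at him
  refine Complex.ext ?_ ?_
  · rw [Complex.ofReal_re]
    exact hre
  · rw [Complex.ofReal_im]
    exact him
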